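/- Let $G$ be a finitely generated group with finitely generated subgroups $H_1,\dots,H_n$. For each $i$ let $X_i\subseteq G$ be a nontrivial $H_i$-almost invariant set: $H_iX_i=X_i$, the image $P$ of $X_i$ in $H_i\backslash G$ has finite symmetric difference with $Pa$ for every $a\in G$, and the images of $X_i$ and of its complement $X_i^*$ in $H_i\backslash G$ are both infinite. Let $E=\{gX_i,\,gX_i^*: g\in G,\ 1\le i\le n\}$. For $U,V\in E$, the corners of $(U,V)$ are $U\cap V$, $U\cap V^*$, $U^*\cap V$, $U^*\cap V^*$; a corner is small if it is contained in finitely many cosets $Hg$, where $H$ is a subgroup over which $U$ is nontrivially almost invariant. Suppose that the $X_i$ are in good position: if two corners of $U,V\in E$ are small, then one of their corners is empty. Write $U\le V$ if $U\cap V^*$ is empty or is the only small corner of $(U,V)$. An ultrafilter on $E$ with respect to an order is a subset $V\subseteq E$ which is upward closed and contains exactly one of $A,A^*$ for each $A\in E$. From an order on $E$ one builds a cube complex: its vertices are the ultrafilters, two of them are joined by an edge if they differ by replacing one element by its complement, and inductively for $m\ge2$ one $m$-cube is attached for each occurrence of the boundary of an $m$-cube in the $(m-1)$-skeleton. Let $K$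 and $\Lambda$ be the complexes obtained from $(E,\subset)$ and from $(E,\le)$. Let $C$ be the component of $K$ that contains the basic vertices $V_g=\{A\in E: g\in A\}$, $g\in G$. Fix a finite generating set of $G$, with Cayley graph $\Gamma$, balls $N_R(g)$ and coboundary operator $\delta$, and call $R>0$ admissible if $A\le B$ in $E$ and $N_R(g)\subseteq A$ imply $g\in B$. For $g\in G$ let $E_R$ be the set of all $A\in E$ such that $\delta A$ meets $N_R(g)$, let $U_g=\{A\in E\setminus E_R: g\in A\}$, and let $U_1$ be the union of $U_g$ and the set of all $B\in E_R$ with $A\le B$ for some $A\in U_g$. A basic vertex $W_g$ of $\Lambda$ is any set obtained from $U_1$ by repeating the following step until nothing is undecided: choose a minimal element $A$ among the undecided elements (those $B\in E$ with neither $B$ nor $B^*$ chosen so far) and add $A$ and all undecided $B$ with $A\le B$. Let $L$ be the component of $\Lambda$ that contains the basic vertices $W_g$. Then $\le$ is a partial order on $E$ that is reversed by complementation, and every ultrafilter for $\le$ is an ultrafilter for $\subset$. The $V_g$ are vertices of $K$ and lie in a single component $C$. An admissible $R$ exists, and for every admissible $R$: for each $g\in G$ at least one $W_g$ exists; every $W_g$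 is a vertex of $\Lambda$ and differs from $V_g$ in only finitely many elements; all the $W_g$ lie in a single component $L$; and there is a natural $G$-equivariant embedding $L\to C$, namely the topological embedding which is the inclusion on vertices and which maps each cube of $L$ isometrically onto the cube of $C$ with the same vertices. -/

import Mathlib

open scoped Pointwise symmDiff

namespace MinimalCubing

/-! ### Almost invariant sets -/

section AlmostInvariant

variable {G : Type*} [Group G]

/-- The set `H \ G` of cosets `H g`. -/
abbrev Cosets (H : Subgroup G) : Type _ := Quotient (QuotientGroup.rightRel H)

/-- The projection `g ↦ H g`. -/
def toCoset (H : Subgroup G) (g : G) : Cosets H := Quotient.mk _ g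

theorem toCoset_eq_iff {H : Subgroup G} {x y : G} :
    toCoset H x = toCoset H y ↔ y * x⁻¹ ∈ H := by
  unfold toCoset
  rw [Quotient.eq, QuotientGroup.rightRel_apply]

/-- The right action of `a : G` on `H \ G`, `H g ↦ H g a`. -/
def cosetMul (H : Subgroup G) (a : G) : Cosets H → Cosets H :=
  Quotient.lift (fun g => toCoset H (g * a)) (by
    intro x y hxy
    have h : y * x⁻¹ ∈ H := QuotientGroup.rightRel_apply.mp hxy
    rw [toCoset_eq_iff]
    simpa [mul_assoc] using h)

/-- `X` is an `H`-almost invariant subset of `G`: it is invariant under left multiplication by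
`H`, and its image `P` in `H \ G` is almost equal to `P a` for every `a` in `G`. -/
structure IsAlmostInvariant (H : Subgroup G) (X : Set G) : Prop where
  invariant : ∀ h ∈ H, ∀ x ∈ X, h * x ∈ X
  almost : ∀ a : G, ((cosetMul H a '' (toCoset H '' X)) ∆ (toCoset H '' X)).Finite

/-- `X` is a nontrivial `H`-almost invariant subset of `G`. -/
structure IsNontrivialAlmostInvariant (H : Subgroup G) (X : Set G) : Prop
    extends IsAlmostInvariant H X where
  infinite : (toCoset H '' X).Infinite
  compl_infinite : (toCoset H '' Xᶜ).Infinite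

/-- `W` is contained in a union of finitely many cosets `H g`. -/
def IsHFinite (H : Subgroup G) (W : Set G) : Prop :=
  ∃ F : Set G, F.Finite ∧ W ⊆ (H : Set G) * F

/-- For nontrivial almost invariant sets `U` and `V`: the set `U ∩ V` is small, that is,
`H`-finite where `U` is almost invariant over `H`.  (The choice of `H` does not matter, because
any two choices are commensurable.) -/
def IsSmallInter (U V : Set G) : Prop :=
  ∃ H : Subgroup G, IsNontrivialAlmostInvariant H U ∧ IsHFinite H (U ∩ V)

/-- `U` or its complement `U*`. -/
def side (U : Set G) : Bool → Set G
  | true => U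
  | false => Uᶜ

/-- The four corners `U ∩ V`, `U ∩ V*`, `U* ∩ V`, `U* ∩ V*` of the pair `(U, V)`. -/
def corner (U V : Set G) (p : Bool × Bool) : Set G := side U p.1 ∩ side V p.2

/-- The corner of `(U, V)` labelled by `p` is small. -/
def IsSmallCorner (U V : Set G) (p : Bool × Bool) : Prop :=
  IsSmallInter (side U p.1) (side V p.2)

/-- The set `E` of all translates of the `X i` and of their complements. -/
def translates {n : ℕ} (X : Fin n → Set G) : Set (Set G) :=
  {A | ∃ (i : Fin n) (g : G), A = g • X i ∨ A = g • (X i)ᶜ}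

/-- The family `X` is in good position: if two of the corners of `U, V ∈ E` are small, then one
of their corners is empty. -/
def GoodPosition {n : ℕ} (X : Fin n → Set G) : Prop :=
  ∀ U ∈ translates X, ∀ V ∈ translates X,
    (∃ p q : Bool × Bool, p ≠ q ∧ IsSmallCorner U V p ∧ IsSmallCorner U V q) →
      ∃ r : Bool × Bool, corner U V r = ∅

/-- Almost inclusion `U ≤ V`: the corner `U ∩ V*` is empty, or it is the only small one among the
four corners of `U` and `V`. -/
def AlmostLE (U V : Set G) : Prop :=
  corner U V (true, false) = ∅ ∨ ∀ p : Bool × Bool, IsSmallCorner U V p ↔ p = (true, false)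

/-! Translation invariance of these notions. -/

theorem side_smul (g : G) (U : Set G) (b : Bool) : side (g • U) b = g • side U b := by
  cases b
  · exact (Set.smul_set_compl).symm
  · rfl

theorem corner_smul (g : G) (U V : Set G) (p : Bool × Bool) :
    corner (g • U) (g • V) p = g • corner U V p := by
  simp only [corner, side_smul, Set.smul_set_inter]

theorem mem_conj_iff {H : Subgroup G} {g x : G} :
    x ∈ H.map (MulAut.conj g).toMonoidHom ↔ g⁻¹ * x * g ∈ H := by
  constructor
  · rintro ⟨h, hh, rfl⟩
    simpa [mul_assoc] using hh
  · intro h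
    exact ⟨_, h, by simp [mul_assoc]⟩

/-- The bijection from `H \ G` to `(g H g⁻¹) \ G` induced by left multiplication by `g`. -/
def cosetTranslate (H : Subgroup G) (g : G) :
    Cosets H → Cosets (H.map (MulAut.conj g).toMonoidHom) :=
  Quotient.lift (fun x => toCoset _ (g * x)) (by
    intro x y hxy
    have h : y * x⁻¹ ∈ H := QuotientGroup.rightRel_apply.mp hxy
    rw [toCoset_eq_iff, mem_conj_iff]
    simpa [mul_assoc] using h)

theorem cosetTranslate_injective (H : Subgroup G) (g : G) :
    Function.Injective (cosetTranslate H g) := by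
  intro a b
  induction a using Quotient.inductionOn with | _ x
  induction b using Quotient.inductionOn with | _ y
  intro h
  have h' : toCoset (H.map (MulAut.conj g).toMonoidHom) (g * x) = toCoset _ (g * y) := h
  rw [toCoset_eq_iff, mem_conj_iff] at h'
  refine toCoset_eq_iff.mpr ?_
  simpa [mul_assoc] using h'

theorem toCoset_image_smul (H : Subgroup G) (g : G) (X : Set G) :
    toCoset (H.map (MulAut.conj g).toMonoidHom) '' (g • X)
      = cosetTranslate H g '' (toCoset H '' X) := by
  rw [← Set.image_smul, Set.image_image, Set.image_image]
  rfl

theorem cosetMul_image_translate (H : Subgroup G) (g a : G) (P : Set (Cosets H)) :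
    cosetMul (H.map (MulAut.conj g).toMonoidHom) a '' (cosetTranslate H g '' P)
      = cosetTranslate H g '' (cosetMul H a '' P) := by
  rw [Set.image_image, Set.image_image]
  refine Set.image_congr' fun c => ?_
  induction c using Quotient.inductionOn with | _ x
  change toCoset _ (g * x * a) = toCoset _ (g * (x * a))
  rw [mul_assoc]

theorem IsNontrivialAlmostInvariant.smul {H : Subgroup G} {X : Set G}
    (h : IsNontrivialAlmostInvariant H X) (g : G) :
    IsNontrivialAlmostInvariant (H.map (MulAut.conj g).toMonoidHom) (g • X) where
  invariant := by
    rintro _ ⟨k, hk, rfl⟩ _ ⟨x, hx, rfl⟩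
    exact ⟨k * x, h.invariant k hk x hx, by simp [mul_assoc]⟩
  almost a := by
    rw [toCoset_image_smul, cosetMul_image_translate,
      ← Set.image_symmDiff (cosetTranslate_injective H g)]
    exact (h.almost a).image _
  infinite := by
    rw [toCoset_image_smul]
    exact h.infinite.image (cosetTranslate_injective H g).injOn
  compl_infinite := by
    rw [← Set.smul_set_compl, toCoset_image_smul]
    exact h.compl_infinite.image (cosetTranslate_injective H g).injOn

theorem IsSmallInter.smul {U V : Set G} (h : IsSmallInter U V) (g : G) :
    IsSmallInter (g • U) (g • V) := by
  obtain ⟨H, hU, F, hF, hsub⟩ := h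
  refine ⟨_, hU.smul g, g • F, hF.smul_set, ?_⟩
  rw [← Set.smul_set_inter]
  rintro _ ⟨x, hx, rfl⟩
  obtain ⟨k, hk, f, hf, rfl⟩ := hsub hx
  exact ⟨g * k * g⁻¹, ⟨k, hk, by simp⟩, g * f, ⟨f, hf, rfl⟩, by simp [mul_assoc]⟩

theorem isSmallCorner_smul_iff (g : G) (U V : Set G) (p : Bool × Bool) :
    IsSmallCorner (g • U) (g • V) p ↔ IsSmallCorner U V p := by
  simp only [IsSmallCorner, side_smul]
  constructor
  · intro h
    simpa using h.smul g⁻¹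
  · intro h
    exact h.smul g

theorem almostLE_smul_iff (g : G) (U V : Set G) :
    AlmostLE (g • U) (g • V) ↔ AlmostLE U V := by
  simp only [AlmostLE, isSmallCorner_smul_iff, corner_smul, Set.smul_set_eq_empty]

theorem smul_mem_translates {n : ℕ} {X : Fin n → Set G} (g : G) {A : Set G}
    (hA : A ∈ translates X) : g • A ∈ translates X := by
  obtain ⟨i, k, rfl | rfl⟩ := hA
  · exact ⟨i, g * k, Or.inl (smul_smul _ _ _)⟩
  · exact ⟨i, g * k, Or.inr (smul_smul _ _ _)⟩

theorem smul_mem_translates_iff {n : ℕ} {X : Fin n → Set G} (g : G) {A : Set G} :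
    g • A ∈ translates X ↔ A ∈ translates X :=
  ⟨fun h => by simpa using smul_mem_translates g⁻¹ h, smul_mem_translates g⟩

end AlmostInvariant

/-! ### The cube complex obtained from a graph by filling in all cubes -/

section CubeComplex

universe u v w

/-- `φ` is the vertex map of an `n`-cube of the cube complex with `1`-skeleton `Γ` that is
constructed inductively as follows: the `0`- and `1`-cubes are the vertices and the edges of `Γ`,
and for `n ≥ 2` an `n`-cube is attached for each occurrence of the boundary of an `n`-cube in
the `(n-1)`-skeleton. -/
def IsCube {V : Type u} (Γ : SimpleGraph V) : (n : ℕ) → ((Fin n → Bool) → V) → Prop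
  | 0, _ => True
  | 1, φ => Γ.Adj (φ fun _ => false) (φ fun _ => true)
  | n + 2, φ => Function.Injective φ ∧
      ∀ (i : Fin (n + 2)) (b : Bool), IsCube Γ (n + 1) fun x => φ (i.insertNth b x)

/-- The parametrised cubes of the complex. -/
def Cell {V : Type u} (Γ : SimpleGraph V) : Type u :=
  Σ n : ℕ, {φ : (Fin n → Bool) → V // IsCube Γ n φ}

/-- The isometry of `{0,1}^m` onto the vertex set of a face of `[0,1]^n` given by an injection
`e` of the coordinates and by `c`: the coordinate `e i` is `x i`, reflected if `c (e i) = 1`, and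
a coordinate `j` outside the range of `e` is constantly `c j`. -/
noncomputable def faceVertex {m n : ℕ} (e : Fin m ↪ Fin n) (c : Fin n → Bool) (x : Fin m → Bool) :
    Fin n → Bool :=
  fun j => xor (c j) (Function.extend e x (fun _ => false) j)

/-- The isometry of `[0,1]^m` onto a face of `[0,1]^n` which extends `faceVertex e c`. -/
noncomputable def facePoint {m n : ℕ} (e : Fin m ↪ Fin n) (c : Fin n → Bool)
    (x : Fin m → unitInterval) : Fin n → unitInterval :=
  fun j => if c j then unitInterval.symm (Function.extend e x (fun _ => 0) j)
    else Function.extend e x (fun _ => 0) j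

/-- The disjoint union of standard cubes `[0,1]^n`, one for each parametrised cube. -/
abbrev CubePoint {V : Type u} (Γ : SimpleGraph V) : Type u :=
  Σ σ : Cell Γ, (Fin σ.1 → unitInterval)

/-- The gluing: if the parametrised cube `ψ` is the face of the parametrised cube `φ` given by
`e` and `c`, then each point of `ψ` is glued to the corresponding point of `φ`.  With `m = n`,
this identifies the different parametrisations of the same cube. -/
inductive Glue {V : Type u} (Γ : SimpleGraph V) : CubePoint Γ → CubePoint Γ → Prop
  | face {m n : ℕ} (ψ : {ψ : (Fin m → Bool) → V // IsCube Γ m ψ})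
      (φ : {φ : (Fin n → Bool) → V // IsCube Γ n φ}) (e : Fin m ↪ Fin n) (c : Fin n → Bool)
      (h : ∀ y, ψ.1 y = φ.1 (faceVertex e c y)) (x : Fin m → unitInterval) :
      Glue Γ ⟨⟨m, ψ⟩, x⟩ ⟨⟨n, φ⟩, facePoint e c x⟩

/-- The cube complex with `1`-skeleton `Γ`, as a topological space (with the quotient topology
of the disjoint union of its cubes). -/
def Realization {V : Type u} (Γ : SimpleGraph V) : Type u := Quot (Glue Γ)

instance {V : Type u} (Γ : SimpleGraph V) : TopologicalSpace (Realization Γ) :=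
  inferInstanceAs (TopologicalSpace (Quot (Glue Γ)))

theorem IsCube.map {V : Type u} {V' : Type v} {Γ : SimpleGraph V} {Γ' : SimpleGraph V'}
    (f : Γ.Copy Γ') : ∀ {n : ℕ} {φ : (Fin n → Bool) → V}, IsCube Γ n φ →
      IsCube Γ' n (fun y => f (φ y))
  | 0, _, _ => trivial
  | 1, _, h => f.toHom.map_adj h
  | _ + 2, _, h => ⟨f.injective.comp h.1, fun i b => IsCube.map f (h.2 i b)⟩

/-- The image of a parametrised cube under an injective graph homomorphism. -/
def Cell.map {V : Type u} {V' : Type v} {Γ : SimpleGraph V} {Γ' : SimpleGraph V'}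
    (f : Γ.Copy Γ') (σ : Cell Γ) : Cell Γ' :=
  ⟨σ.1, fun y => f (σ.2.1 y), σ.2.2.map f⟩

/-- The map of cube complexes induced by an injective graph homomorphism `f`: it maps the cube
`φ` by the identity of `[0,1]^n` onto the cube `f ∘ φ`. -/
def Realization.map {V : Type u} {V' : Type v} {Γ : SimpleGraph V} {Γ' : SimpleGraph V'}
    (f : Γ.Copy Γ') : Realization Γ → Realization Γ' :=
  Quot.map (fun p => ⟨p.1.map f, p.2⟩) (by
    rintro _ _ ⟨ψ, φ, e, c, h, x⟩
    exact Glue.face (m := _) (n := _) ⟨fun y => f (ψ.1 y), ψ.2.map f⟩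
      ⟨fun y => f (φ.1 y), φ.2.map f⟩ e c (fun y => congrArg f (h y)) x)

theorem Realization.map_id {V : Type u} {Γ : SimpleGraph V} (f : Γ.Copy Γ)
    (hf : ∀ v, f v = v) (x : Realization Γ) : Realization.map f x = x := by
  obtain rfl : f = SimpleGraph.Copy.id Γ := SimpleGraph.Copy.ext hf
  induction x using Quot.inductionOn with | _ p
  rfl

theorem Realization.map_map {V : Type u} {V' : Type v} {V'' : Type w} {Γ : SimpleGraph V}
    {Γ' : SimpleGraph V'} {Γ'' : SimpleGraph V''} (f : Γ.Copy Γ') (f' : Γ'.Copy Γ'')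
    (k : Γ.Copy Γ'') (hk : ∀ v, k v = f' (f v)) (x : Realization Γ) :
    Realization.map f' (Realization.map f x) = Realization.map k x := by
  obtain rfl : k = f'.comp f := SimpleGraph.Copy.ext hk
  induction x using Quot.inductionOn with | _ p
  rfl

end CubeComplex

/-! ### Ultrafilters and the associated cube complexes -/

section Cubing

variable {G : Type*} [Group G]

/-- `V` is an ultrafilter on the set `E` of subsets of `G` (closed under complementation) with
respect to the partial order `r` and the involution `A ↦ A*`. -/
structure IsUltrafilterOn (E : Set (Set G)) (r : Set G → Set G → Prop) (V : Set (Set G)) :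
    Prop where
  subset : V ⊆ E
  mem_xor : ∀ A ∈ E, (A ∈ V ∨ Aᶜ ∈ V) ∧ ¬ (A ∈ V ∧ Aᶜ ∈ V)
  upward : ∀ A ∈ V, ∀ B ∈ E, r A B → B ∈ V

/-- The data for the construction: a `G`-invariant set `E` of subsets of `G`, a `G`-invariant
relation on it, and a `G`-invariant collection of basic vertices. -/
structure CubingData (G : Type*) [Group G] where
  E : Set (Set G)
  rel : Set G → Set G → Prop
  basic : Set (Set (Set G))
  smul_mem : ∀ (g : G) (A : Set G), A ∈ E → g • A ∈ E
  rel_smul : ∀ (g : G) (A B : Set G), rel A B → rel (g • A) (g • B)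
  basic_smul : ∀ (g : G) (V : Set (Set G)), V ∈ basic → g • V ∈ basic

theorem IsUltrafilterOn.smul {D : CubingData G} {V : Set (Set G)}
    (h : IsUltrafilterOn D.E D.rel V) (g : G) : IsUltrafilterOn D.E D.rel (g • V) where
  subset := by
    rintro _ ⟨A, hA, rfl⟩
    exact D.smul_mem g A (h.subset hA)
  mem_xor A hA := by
    have := h.mem_xor (g⁻¹ • A) (D.smul_mem _ _ hA)
    rwa [Set.mem_smul_set_iff_inv_smul_mem, Set.mem_smul_set_iff_inv_smul_mem,
      Set.smul_set_compl]
  upward A hA B hB hAB := by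
    rw [Set.mem_smul_set_iff_inv_smul_mem] at hA ⊢
    exact h.upward _ hA _ (D.smul_mem _ _ hB) (D.rel_smul _ _ _ hAB)

/-- The vertices of the whole complex: all ultrafilters. -/
abbrev CubingData.Ultra (D : CubingData G) : Type _ :=
  {V : Set (Set G) // IsUltrafilterOn D.E D.rel V}

/-- The `1`-skeleton of the whole complex: two ultrafilters are joined by an edge if they differ
by replacing one element by its complement. -/
def CubingData.fullGraph (D : CubingData G) : SimpleGraph D.Ultra where
  Adj V V' := ∃ A ∈ V.1, V'.1 = (V.1 \ {A}) ∪ {Aᶜ}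
  symm := ⟨by
    rintro ⟨V, hV⟩ ⟨V', hV'⟩ ⟨A, hA, h⟩
    simp only at hA h
    have hc : Aᶜ ∉ V := fun hc => (hV.mem_xor A (hV.subset hA)).2 ⟨hA, hc⟩
    refine ⟨Aᶜ, by simp [h], ?_⟩
    simp only [h, compl_compl]
    ext B
    simp only [Set.mem_union, Set.mem_sdiff, Set.mem_singleton_iff]
    constructor
    · intro hB
      by_cases hBA : B = A
      · exact Or.inr hBA
      · exact Or.inl ⟨Or.inl ⟨hB, hBA⟩, fun h' => hc (h' ▸ hB)⟩
    · rintro (⟨⟨hB, _⟩ | hB, hB'⟩ | rfl)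
      · exact hB
      · exact absurd hB hB'
      · exact hA⟩
  loopless := ⟨by
    rintro ⟨V, hV⟩ ⟨A, hA, h⟩
    simp only at hA h
    have hc : Aᶜ ∈ V := by rw [h]; simp
    exact (hV.mem_xor A (hV.subset hA)).2 ⟨hA, hc⟩⟩

/-- The action of `g` on the ultrafilters. -/
def CubingData.actUltra (D : CubingData G) (g : G) (V : D.Ultra) : D.Ultra :=
  ⟨g • V.1, V.2.smul g⟩

theorem CubingData.actUltra_adj (D : CubingData G) (g : G) {V V' : D.Ultra}
    (h : D.fullGraph.Adj V V') : D.fullGraph.Adj (D.actUltra g V) (D.actUltra g V') := by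
  obtain ⟨A, hA, h⟩ := h
  refine ⟨g • A, Set.smul_mem_smul_set hA, ?_⟩
  change g • V'.1 = (g • V.1 \ {g • A}) ∪ {(g • A)ᶜ}
  rw [h, Set.smul_set_union, Set.smul_set_sdiff, Set.smul_set_singleton, Set.smul_set_singleton,
    Set.smul_set_compl]

/-- The vertices of the part of the complex that is connected to the basic vertices. -/
abbrev CubingData.Vertex (D : CubingData G) : Type _ :=
  {V : D.Ultra // ∃ W : D.Ultra, W.1 ∈ D.basic ∧ D.fullGraph.Reachable W V}

/-- The `1`-skeleton of the part of the complex that is connected to the basic vertices. -/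
def CubingData.graph (D : CubingData G) : SimpleGraph D.Vertex :=
  D.fullGraph.comap Subtype.val

/-- The action of `g` on the `1`-skeleton. -/
def CubingData.act (D : CubingData G) (g : G) : D.graph.Copy D.graph :=
  SimpleGraph.Hom.toCopy
    { toFun := fun V => ⟨D.actUltra g V.1, by
        obtain ⟨W, hW, hr⟩ := V.2
        refine ⟨D.actUltra g W, D.basic_smul g _ hW, ?_⟩
        exact hr.map (⟨D.actUltra g, fun h => D.actUltra_adj g h⟩ : D.fullGraph →g D.fullGraph)⟩
      map_rel' := fun h => D.actUltra_adj g h }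
    (by
      intro V V' h
      have h' : g • V.1.1 = g • V'.1.1 := congrArg (fun U : D.Vertex => U.1.1) h
      exact Subtype.ext (Subtype.ext (smul_left_cancel g h')))

/-- The cube complex spanned by the vertices that are connected to the basic vertices. -/
def CubingData.Complex (D : CubingData G) : Type _ := Realization D.graph

instance (D : CubingData G) : TopologicalSpace D.Complex :=
  inferInstanceAs (TopologicalSpace (Realization D.graph))

/-- The action of `G` on the cube complex. -/
instance (D : CubingData G) : MulAction G D.Complex where
  smul g x := Realization.map (D.act g) x
  one_smul x := Realization.map_id (D.act 1)
    (fun V => Subtype.ext (Subtype.ext (one_smul G V.1.1))) x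
  mul_smul g k x := (Realization.map_map (D.act k) (D.act g) (D.act (g * k))
    (fun V => Subtype.ext (Subtype.ext (mul_smul g k V.1.1))) x).symm

/-! ### The cubing for inclusion -/

/-- The basic vertex `V_g`, the set of all elements of `E` that contain `g`. -/
def basicV (E : Set (Set G)) (g : G) : Set (Set G) := {A ∈ E | g ∈ A}

/-- The data of the cubing `C`, constructed from `E` with inclusion. -/
def cubingC {n : ℕ} (X : Fin n → Set G) : CubingData G where
  E := translates X
  rel := fun A B => A ⊆ B
  basic := Set.range (basicV (translates X))
  smul_mem := fun g _ hA => smul_mem_translates g hA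
  rel_smul := fun _ _ _ h => Set.smul_set_mono h
  basic_smul := by
    rintro g _ ⟨k, rfl⟩
    refine ⟨g * k, ?_⟩
    ext A
    rw [Set.mem_smul_set_iff_inv_smul_mem]
    simp only [basicV, Set.mem_ofPred_eq, smul_mem_translates_iff,
      Set.mem_smul_set_iff_inv_smul_mem, inv_inv, smul_eq_mul]

/-! ### The cubing for almost inclusion -/

/-- The ball `N_R(g)` (its set of vertices) in the Cayley graph with respect to `S`. -/
def ball (S : Set G) (R : ℕ) (g : G) : Set G := {h | (SimpleGraph.mulCayley S).edist g h ≤ R}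

/-- The coboundary `δA`: the edges of the Cayley graph that join `A` to its complement. -/
def coboundary (S : Set G) (A : Set G) : Set (Sym2 G) :=
  {e | ∃ a ∈ A, ∃ b ∈ Aᶜ, (SimpleGraph.mulCayley S).Adj a b ∧ e = s(a, b)}

/-- The radius `R` is large enough for the construction of basic vertices: if `A ≤ B` in `E`, and
`N_R(g) ⊆ A`, then `g ∈ B`. -/
def IsAdmissibleRadius {n : ℕ} (X : Fin n → Set G) (S : Set G) (R : ℕ) : Prop :=
  0 < R ∧ ∀ A ∈ translates X, ∀ B ∈ translates X, AlmostLE A B →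
    ∀ g ∈ A, ball S R g ⊆ A → g ∈ B

/-- The set `E_R` of the elements of `E` whose coboundary meets the ball `N_R(g)`. -/
def nearSets {n : ℕ} (X : Fin n → Set G) (S : Set G) (R : ℕ) (g : G) : Set (Set G) :=
  {A ∈ translates X | ∃ e ∈ coboundary S A, ∃ v ∈ ball S R g, v ∈ e}

/-- The set `U_g` of the elements of `E - E_R` that contain `g`. -/
def initialU {n : ℕ} (X : Fin n → Set G) (S : Set G) (R : ℕ) (g : G) : Set (Set G) :=
  {A ∈ translates X \ nearSets X S R g | g ∈ A}

/-- The set `U_1`, obtained from `U_g` by adding the elements of `E_R` above an element of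
`U_g`. -/
def firstU {n : ℕ} (X : Fin n → Set G) (S : Set G) (R : ℕ) (g : G) : Set (Set G) :=
  initialU X S R g ∪ {B ∈ nearSets X S R g | ∃ A ∈ initialU X S R g, AlmostLE A B}

/-- The set `E - (U ∪ U*)` of the elements of `E` not yet decided by `U`. -/
def undecided (E U : Set (Set G)) : Set (Set G) := {A ∈ E | A ∉ U ∧ Aᶜ ∉ U}

/-- One step of the completion: choose a minimal undecided `A` and add it, together with all
undecided elements above `A`. -/
def CompletionStep (E : Set (Set G)) (r : Set G → Set G → Prop) (U U' : Set (Set G)) : Prop :=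
  ∃ A ∈ undecided E U, (∀ B ∈ undecided E U, r B A → B = A) ∧
    U' = U ∪ {A} ∪ {B ∈ undecided E U | r A B}

/-- `W` is a basic vertex `W_g` for almost inclusion: it is obtained from `U_1` by finitely many
completion steps, after which nothing is undecided. -/
def IsBasicW {n : ℕ} (X : Fin n → Set G) (S : Set G) (R : ℕ) (g : G) (W : Set (Set G)) : Prop :=
  Relation.ReflTransGen (CompletionStep (translates X) AlmostLE) (firstU X S R g) W ∧
    undecided (translates X) W = ∅

theorem mulCayley_adj_smul (S : Set G) (g : G) {a b : G}
    (h : (SimpleGraph.mulCayley S).Adj a b) :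
    (SimpleGraph.mulCayley S).Adj (g * a) (g * b) := by
  rw [SimpleGraph.mulCayley_adj'] at h ⊢
  obtain ⟨hne, s, hs, h⟩ := h
  refine ⟨fun h' => hne (mul_left_cancel h'), s, hs, ?_⟩
  rcases h with h | h
  · exact Or.inl (by rw [mul_assoc, h])
  · exact Or.inr (by rw [mul_assoc, ← h])

theorem edist_smul_le (S : Set G) (g a b : G) :
    (SimpleGraph.mulCayley S).edist (g * a) (g * b) ≤ (SimpleGraph.mulCayley S).edist a b := by
  rw [SimpleGraph.edist_eq_sInf (u := a)]
  refine le_sInf ?_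
  rintro _ ⟨p, rfl⟩
  let f : SimpleGraph.mulCayley S →g SimpleGraph.mulCayley S :=
    ⟨fun x => g * x, fun h => mulCayley_adj_smul S g h⟩
  have := SimpleGraph.edist_le (p.map f)
  rw [SimpleGraph.Walk.length_map] at this
  exact this

theorem mem_ball_smul (S : Set G) (R : ℕ) (k g h : G) (hh : h ∈ ball S R g) :
    k * h ∈ ball S R (k * g) :=
  (edist_smul_le S k g h).trans hh

theorem smul_mem_nearSets {n : ℕ} {X : Fin n → Set G} {S : Set G} {R : ℕ} {g : G} (k : G)
    {A : Set G} (hA : A ∈ nearSets X S R g) : k • A ∈ nearSets X S R (k * g) := by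
  obtain ⟨hE, e, ⟨a, ha, b, hb, hab, rfl⟩, v, hv, hve⟩ := hA
  refine ⟨smul_mem_translates k hE, s(k * a, k * b),
    ⟨k * a, Set.smul_mem_smul_set ha, k * b, ?_, mulCayley_adj_smul S k hab, rfl⟩,
    k * v, mem_ball_smul S R k g v hv, ?_⟩
  · rw [← Set.smul_set_compl]
    exact Set.smul_mem_smul_set hb
  · rw [Sym2.mem_iff] at hve ⊢
    rcases hve with rfl | rfl
    · exact Or.inl rfl
    · exact Or.inr rfl

theorem smul_mem_nearSets_iff {n : ℕ} {X : Fin n → Set G} {S : Set G} {R : ℕ} {g : G} (k : G)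
    {A : Set G} : k • A ∈ nearSets X S R (k * g) ↔ A ∈ nearSets X S R g :=
  ⟨fun h => by simpa using smul_mem_nearSets k⁻¹ h, smul_mem_nearSets k⟩

theorem smul_mem_initialU_iff {n : ℕ} {X : Fin n → Set G} {S : Set G} {R : ℕ} {g : G} (k : G)
    {A : Set G} : k • A ∈ initialU X S R (k * g) ↔ A ∈ initialU X S R g := by
  simp only [initialU, Set.mem_ofPred_eq, Set.mem_sdiff, smul_mem_translates_iff,
    smul_mem_nearSets_iff, Set.mem_smul_set_iff_inv_smul_mem, smul_eq_mul, inv_mul_cancel_left]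

theorem smul_firstU {n : ℕ} (X : Fin n → Set G) (S : Set G) (R : ℕ) (g k : G) :
    k • firstU X S R g = firstU X S R (k * g) := by
  ext B
  obtain ⟨B, rfl⟩ : ∃ B', B = k • B' := ⟨k⁻¹ • B, by simp⟩
  rw [Set.smul_mem_smul_set_iff]
  simp only [firstU, Set.mem_union, Set.mem_ofPred_eq, smul_mem_initialU_iff,
    smul_mem_nearSets_iff]
  refine or_congr Iff.rfl (and_congr Iff.rfl ⟨?_, ?_⟩)
  · rintro ⟨A, hA, h⟩
    exact ⟨k • A, (smul_mem_initialU_iff k).mpr hA, (almostLE_smul_iff k A B).mpr h⟩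
  · rintro ⟨A, hA, h⟩
    obtain ⟨A, rfl⟩ : ∃ A', A = k • A' := ⟨k⁻¹ • A, by simp⟩
    exact ⟨A, (smul_mem_initialU_iff k).mp hA, (almostLE_smul_iff k A B).mp h⟩

theorem smul_undecided {n : ℕ} (X : Fin n → Set G) (U : Set (Set G)) (k : G) :
    undecided (translates X) (k • U) = k • undecided (translates X) U := by
  ext B
  obtain ⟨B, rfl⟩ : ∃ B', B = k • B' := ⟨k⁻¹ • B, by simp⟩
  simp only [undecided, Set.smul_mem_smul_set_iff, Set.mem_ofPred_eq, smul_mem_translates_iff,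
    ← Set.smul_set_compl]

theorem CompletionStep.smul {n : ℕ} {X : Fin n → Set G} {U U' : Set (Set G)}
    (h : CompletionStep (translates X) AlmostLE U U') (k : G) :
    CompletionStep (translates X) AlmostLE (k • U) (k • U') := by
  obtain ⟨A, hA, hmin, rfl⟩ := h
  refine ⟨k • A, ?_, ?_, ?_⟩
  · rw [smul_undecided]
    exact Set.smul_mem_smul_set hA
  · rw [smul_undecided]
    rintro _ ⟨B, hB, rfl⟩ hBA
    exact congrArg _ (hmin B hB ((almostLE_smul_iff k B A).mp hBA))
  · rw [Set.smul_set_union, Set.smul_set_union, Set.smul_set_singleton, smul_undecided]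
    congr 1
    ext B
    obtain ⟨B, rfl⟩ : ∃ B', B = k • B' := ⟨k⁻¹ • B, by simp⟩
    simp only [Set.smul_mem_smul_set_iff, Set.mem_ofPred_eq, almostLE_smul_iff]

theorem IsBasicW.smul {n : ℕ} {X : Fin n → Set G} {S : Set G} {R : ℕ} {g : G}
    {W : Set (Set G)} (h : IsBasicW X S R g W) (k : G) :
    IsBasicW X S R (k * g) (k • W) := by
  refine ⟨?_, ?_⟩
  · rw [← smul_firstU]
    have h1 := h.1
    clear h
    induction h1 with
    | refl => exact Relation.ReflTransGen.refl
    | tail _ hs ih => exact ih.tail (hs.smul k)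
  · rw [smul_undecided, h.2, Set.smul_set_empty]

/-- The data of the cubing `L`, constructed from `E` with almost inclusion. -/
def cubingL {n : ℕ} (X : Fin n → Set G) (S : Set G) (R : ℕ) : CubingData G where
  E := translates X
  rel := AlmostLE
  basic := {W | ∃ g : G, IsBasicW X S R g W}
  smul_mem := fun g _ hA => smul_mem_translates g hA
  rel_smul := fun g A B h => (almostLE_smul_iff g A B).mpr h
  basic_smul := by
    rintro g W ⟨k, hW⟩
    exact ⟨g * k, hW.smul g⟩

end Cubing

end MinimalCubing

/-! Almost inclusion weakens inclusion only by allowing a single small corner. Smallness of an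
intersection is symmetric and passes along almost inclusions, because an `H`-finite set contained
in a `K`-almost invariant set is `K`-finite as soon as the latter avoids, up to an `H`-finite set,
some large `H`-invariant set; this makes `≤` a partial order reversed by complementation.

Only finitely many elements of `E` separate two points of `G` or cross a given ball, so any two
vertices to be connected differ by finitely many elements, and they are joined by replacing the
minimal elements of the difference one at a time. For the admissible radius, the pairs of elements
of `E` whose boundaries cross form finitely many `G`-orbits; every other pair has an empty corner,
where almost inclusion is honest inclusion, and each of the finitely many orbits only asks for some
finite radius.

An injective map of graphs maps the cubes injectively, and the faces of a cube of the target that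
come from the source form a finite closed union of faces. Two such faces can only meet in a common
face, which again comes from the source; so no gluing happens in the image that does not already
happen in the source, and the induced map of complexes is a closed embedding. -/

namespace MinimalCubing

/-! ### Finiteness modulo a subgroup -/

section HFinite

variable {G : Type*} [Group G] {H K : Subgroup G} {U V W X Z : Set G}

theorem isHFinite_iff_finite_image : IsHFinite H W ↔ (toCoset H '' W).Finite := by
  constructor
  · rintro ⟨F, hF, hW⟩
    refine (hF.image (toCoset H)).subset ?_
    rintro _ ⟨x, hx, rfl⟩
    obtain ⟨h, hh, f, hf, rfl⟩ := hW hx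
    exact ⟨f, hf, toCoset_eq_iff.mpr (by simpa using hh)⟩
  · intro h
    refine ⟨Quotient.out '' (toCoset H '' W), h.image _, fun x hx => ?_⟩
    have hout : toCoset H (toCoset H x).out = toCoset H x := Quotient.out_eq _
    exact ⟨_, toCoset_eq_iff.mp hout, _, ⟨_, ⟨x, hx, rfl⟩, rfl⟩, by simp⟩

theorem isHFinite_empty (H : Subgroup G) : IsHFinite H (∅ : Set G) :=
  ⟨∅, Set.finite_empty, Set.empty_subset _⟩

theorem IsHFinite.mono (h : IsHFinite H W) (hZW : Z ⊆ W) : IsHFinite H Z := by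
  obtain ⟨F, hF, hWF⟩ := h
  exact ⟨F, hF, hZW.trans hWF⟩

theorem IsHFinite.union (hW : IsHFinite H W) (hZ : IsHFinite H Z) : IsHFinite H (W ∪ Z) := by
  rw [isHFinite_iff_finite_image] at *
  rw [Set.image_union]
  exact hW.union hZ

theorem IsHFinite.biUnion {ι : Type*} {s : Set ι} (hs : s.Finite) {W : ι → Set G}
    (h : ∀ i ∈ s, IsHFinite H (W i)) : IsHFinite H (⋃ i ∈ s, W i) := by
  rw [isHFinite_iff_finite_image, Set.image_iUnion₂]
  exact hs.biUnion fun i hi => isHFinite_iff_finite_image.mp (h i hi)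

theorem IsHFinite.of_inter_of_inter_compl (h : IsHFinite H (U ∩ V)) (h' : IsHFinite H (U ∩ Vᶜ)) :
    IsHFinite H U :=
  Set.inter_union_compl U V ▸ h.union h'

theorem IsAlmostInvariant.mul_mem_iff (hX : IsAlmostInvariant H X) {h x : G} (hh : h ∈ H) :
    h * x ∈ X ↔ x ∈ X :=
  ⟨fun hx => by simpa using hX.invariant h⁻¹ (H.inv_mem hh) _ hx, hX.invariant h hh x⟩

theorem IsAlmostInvariant.smul_eq (hX : IsAlmostInvariant H X) {h : G} (hh : h ∈ H) :
    h • X = X := by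
  ext x
  rw [Set.mem_smul_set_iff_inv_smul_mem]
  exact hX.mul_mem_iff (H.inv_mem hh)

theorem cosetMul_bijective (H : Subgroup G) (a : G) : Function.Bijective (cosetMul H a) := by
  refine Function.bijective_iff_has_inverse.mpr ⟨cosetMul H a⁻¹, fun c => ?_, fun c => ?_⟩ <;>
  · induction c using Quotient.inductionOn with | _ x
    exact congrArg (toCoset H) (by simp [mul_assoc])

theorem IsAlmostInvariant.image_toCoset_compl (hX : IsAlmostInvariant H X) :
    toCoset H '' Xᶜ = (toCoset H '' X)ᶜ := by
  ext c
  induction c using Quotient.inductionOn with | _ x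
  constructor
  · rintro ⟨y, hy, hyx⟩ ⟨z, hz, hzx⟩
    have hyz : y * z⁻¹ ∈ H := toCoset_eq_iff.mp (hzx.trans hyx.symm)
    exact hy (by simpa using hX.invariant _ hyz z hz)
  · exact fun h => ⟨x, fun hx => h ⟨x, hx, rfl⟩, rfl⟩

theorem IsAlmostInvariant.compl (hX : IsAlmostInvariant H X) : IsAlmostInvariant H Xᶜ where
  invariant _ hh _ hx h := hx ((hX.mul_mem_iff hh).mp h)
  almost a := by
    rw [hX.image_toCoset_compl, Set.image_compl_eq (cosetMul_bijective H a), compl_symmDiff_compl]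
    exact hX.almost a

theorem IsAlmostInvariant.isHFinite_mul_notMem (hX : IsAlmostInvariant H X) (a : G) :
    IsHFinite H {x ∈ X | x * a ∉ X} := by
  rw [isHFinite_iff_finite_image]
  refine (hX.almost a⁻¹).subset ?_
  rintro _ ⟨x, ⟨hx, hxa⟩, rfl⟩
  refine Or.inr ⟨⟨x, hx, rfl⟩, ?_⟩
  rintro ⟨_, ⟨y, hy, rfl⟩, hyx⟩
  have hxy : x * (y * a⁻¹)⁻¹ ∈ H := toCoset_eq_iff.mp hyx
  exact hxa (by simpa [mul_assoc] using hX.invariant _ hxy y hy)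

/-- For `z ∈ Z` far from `U ∩ Z`, the right translation taking `f` to `z` moves `H f` into
`H z ⊆ Z` and out of `U`; so `U ∩ H f` lies in a set `{x ∈ U | x * a ∉ U}`. -/
theorem IsAlmostInvariant.isHFinite_of_isHFinite (hU : IsAlmostInvariant K U)
    (hZ : ∀ h ∈ H, ∀ z ∈ Z, h * z ∈ Z) (hZ' : ¬ IsHFinite H Z) (hUZ : IsHFinite H (U ∩ Z))
    (hWU : W ⊆ U) (hW : IsHFinite H W) : IsHFinite K W := by
  obtain ⟨F, hF, hWF⟩ := hW
  obtain ⟨F', hF', hUF'⟩ := hUZ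
  obtain ⟨z, hz, hzF'⟩ : ∃ z ∈ Z, z ∉ (H : Set G) * F' := by
    by_contra! h
    exact hZ' ⟨F', hF', h⟩
  have hzU : ∀ h ∈ H, h * z ∉ U := by
    intro h hh hhz
    obtain ⟨k, hk, f', hf', hkf⟩ := hUF' ⟨hhz, hZ h hh z hz⟩
    exact hzF' ⟨h⁻¹ * k, H.mul_mem (H.inv_mem hh) hk, f', hf', by
      simpa [mul_assoc, inv_mul_eq_iff_eq_mul] using hkf⟩
  refine (IsHFinite.biUnion hF fun f _ => hU.isHFinite_mul_notMem (f⁻¹ * z)).mono fun x hx => ?_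
  obtain ⟨h, hh, f, hf, rfl⟩ := hWF hx
  exact Set.mem_biUnion hf ⟨hWU hx, by simpa [mul_assoc] using hzU h hh⟩

theorem IsNontrivialAlmostInvariant.compl (hX : IsNontrivialAlmostInvariant H X) :
    IsNontrivialAlmostInvariant H Xᶜ where
  toIsAlmostInvariant := hX.toIsAlmostInvariant.compl
  infinite := hX.compl_infinite
  compl_infinite := (compl_compl X).symm ▸ hX.infinite

theorem IsNontrivialAlmostInvariant.not_isHFinite (hX : IsNontrivialAlmostInvariant H X) :
    ¬ IsHFinite H X :=
  fun h => hX.infinite (isHFinite_iff_finite_image.mp h)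

theorem isHFinite_inter_iff (hU : IsNontrivialAlmostInvariant H U)
    (hV : IsNontrivialAlmostInvariant K V) : IsHFinite H (U ∩ V) ↔ IsHFinite K (U ∩ V) where
  mp h := hV.isHFinite_of_isHFinite hU.invariant hU.not_isHFinite (Set.inter_comm U V ▸ h)
    Set.inter_subset_right h
  mpr h := hU.isHFinite_of_isHFinite hV.invariant hV.not_isHFinite h Set.inter_subset_left h

end HFinite

/-! ### Small intersections and almost inclusion -/

section AlmostInclusion

variable {G : Type*} [Group G] {A B D : Set G}

/-- `A` is a nontrivial almost invariant set over some subgroup. All elements of `E` are, but over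
different subgroups, and most facts about smallness do not refer to the subgroup. -/
def IsNontrivial (A : Set G) : Prop := ∃ H : Subgroup G, IsNontrivialAlmostInvariant H A

theorem IsNontrivial.compl (h : IsNontrivial A) : IsNontrivial Aᶜ :=
  h.imp fun _ hH => hH.compl

theorem IsNontrivial.side (h : IsNontrivial A) : ∀ b : Bool, IsNontrivial (side A b)
  | true => h
  | false => h.compl

theorem IsNontrivial.ne_univ (h : IsNontrivial A) : A ≠ Set.univ := by
  rintro rfl
  obtain ⟨H, hH⟩ := h
  exact hH.compl_infinite (by simp)

theorem isSmallInter_iff {H : Subgroup G} (hA : IsNontrivialAlmostInvariant H A)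
    (hB : IsNontrivial B) : IsSmallInter A B ↔ IsHFinite H (A ∩ B) := by
  obtain ⟨K, hB⟩ := hB
  refine ⟨?_, fun h => ⟨H, hA, h⟩⟩
  rintro ⟨H', hA', h⟩
  exact (isHFinite_inter_iff hA hB).mpr ((isHFinite_inter_iff hA' hB).mp h)

theorem IsSmallInter.symm (hB : IsNontrivial B) (h : IsSmallInter A B) : IsSmallInter B A := by
  obtain ⟨K, hB⟩ := hB
  obtain ⟨H, hA, h⟩ := h
  exact ⟨K, hB, Set.inter_comm A B ▸ (isHFinite_inter_iff hA hB).mp h⟩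

theorem isSmallInter_of_eq_empty (hA : IsNontrivial A) (h : A ∩ B = ∅) : IsSmallInter A B := by
  obtain ⟨H, hA⟩ := hA
  exact ⟨H, hA, h ▸ isHFinite_empty H⟩

theorem IsSmallInter.not_compl_right (hB : IsNontrivial B) (h : IsSmallInter A B) :
    ¬ IsSmallInter A Bᶜ := by
  intro h'
  obtain ⟨H, hA, h⟩ := h
  exact hA.not_isHFinite (h.of_inter_of_inter_compl ((isSmallInter_iff hA hB.compl).mp h'))

theorem IsSmallInter.trans (hB : IsNontrivial B) (hD : IsNontrivial D)
    (hAB : IsSmallInter A Bᶜ) (hBD : IsSmallInter B Dᶜ) : IsSmallInter A Dᶜ := by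
  obtain ⟨H, hA, hAB⟩ := hAB
  obtain ⟨K, hB⟩ := hB
  have hAB' : IsHFinite K (A ∩ Bᶜ) := (isHFinite_inter_iff hA hB.compl).mp hAB
  have hBD' : IsHFinite K (B ∩ Dᶜ) := (isSmallInter_iff hB hD.compl).mp hBD
  have hAD : A ∩ Dᶜ ⊆ (A ∩ Bᶜ) ∪ (B ∩ Dᶜ) := fun x ⟨hxA, hxD⟩ =>
    (em (x ∈ B)).symm.imp (fun hxB => ⟨hxA, hxB⟩) fun hxB => ⟨hxB, hxD⟩
  exact ⟨H, hA, hA.isHFinite_of_isHFinite hB.compl.invariant hB.compl.not_isHFinite hAB'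
    Set.inter_subset_left ((hAB'.union hBD').mono hAD)⟩

theorem corner_true_false_eq_empty_iff {G : Type*} {A B : Set G} :
    corner A B (true, false) = ∅ ↔ A ⊆ B :=
  Set.disjoint_iff_inter_eq_empty.symm.trans Set.disjoint_compl_right_iff_subset

theorem almostLE_of_subset (h : A ⊆ B) : AlmostLE A B :=
  Or.inl (corner_true_false_eq_empty_iff.mpr h)

theorem almostLE_iff (hA : IsNontrivial A) (hB : IsNontrivial B) :
    AlmostLE A B ↔ A ⊆ B ∨ IsSmallInter A Bᶜ ∧ ¬ IsSmallInter Aᶜ B := by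
  rw [AlmostLE, corner_true_false_eq_empty_iff]
  refine or_congr Iff.rfl ⟨fun h => ⟨(h (true, false)).mpr rfl, fun hc => ?_⟩, ?_⟩
  · simpa using (h (false, true)).mp hc
  · rintro ⟨h10, h01⟩ ⟨a, b⟩
    have h11 : ¬ IsSmallInter A B := fun h => h.not_compl_right hB h10
    have h00 : ¬ IsSmallInter Aᶜ Bᶜ := fun h =>
      (h10.symm hB.compl).not_compl_right hA (h.symm hB.compl)
    cases a <;> cases b <;> simp [IsSmallCorner, side, h10, h01, h11, h00]

theorem AlmostLE.isSmallInter (hA : IsNontrivial A) (h : AlmostLE A B) : IsSmallInter A Bᶜ :=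
  h.elim (isSmallInter_of_eq_empty hA) fun h => (h (true, false)).mpr rfl

theorem AlmostLE.subset_of_corner_eq_empty (hA : IsNontrivial A) (h : AlmostLE A B)
    {p : Bool × Bool} (hp : corner A B p = ∅) : A ⊆ B := by
  rw [← corner_true_false_eq_empty_iff]
  refine h.elim id fun h => ?_
  rwa [← (h p).mp (isSmallInter_of_eq_empty (hA.side p.1) hp)]

theorem not_almostLE_compl (hA : IsNontrivial A) : ¬ AlmostLE A Aᶜ := fun h =>
  IsSmallInter.not_compl_right hA (by simpa using h.isSmallInter hA)
    (isSmallInter_of_eq_empty hA (Set.inter_compl_self A))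

theorem AlmostLE.compl (hA : IsNontrivial A) (hB : IsNontrivial B) (h : AlmostLE A B) :
    AlmostLE Bᶜ Aᶜ := by
  rw [almostLE_iff hA hB] at h
  rw [almostLE_iff hB.compl hA.compl, Set.compl_subset_compl, compl_compl, compl_compl]
  exact h.imp_right fun h => ⟨h.1.symm hB.compl, fun h' => h.2 (h'.symm hA.compl)⟩

theorem AlmostLE.subset_of_isSmallInter (hA : IsNontrivial A) (hB : IsNontrivial B)
    (h : AlmostLE A B) (h' : IsSmallInter B Aᶜ) : A ⊆ B :=
  ((almostLE_iff hA hB).mp h).resolve_right fun h => h.2 (h'.symm hA.compl)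

theorem AlmostLE.antisymm (hA : IsNontrivial A) (hB : IsNontrivial B) (h : AlmostLE A B)
    (h' : AlmostLE B A) : A = B :=
  (h.subset_of_isSmallInter hA hB (h'.isSmallInter hB)).antisymm
    (h'.subset_of_isSmallInter hB hA (h.isSmallInter hA))

/-- If all three of `A`, `B`, `D` agree up to small sets, then both almost inclusions are
inclusions. -/
theorem AlmostLE.trans (hA : IsNontrivial A) (hB : IsNontrivial B) (hD : IsNontrivial D)
    (hAB : AlmostLE A B) (hBD : AlmostLE B D) : AlmostLE A D := by
  have sAB := hAB.isSmallInter hA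
  have sBD := hBD.isSmallInter hB
  rw [almostLE_iff hA hD]
  refine or_iff_not_imp_right.mpr fun h => ?_
  have sDA : IsSmallInter D Aᶜ := by
    by_contra hDA
    exact h ⟨sAB.trans hB hD sBD, fun h' => hDA (h'.symm hD)⟩
  exact (hAB.subset_of_isSmallInter hA hB (sBD.trans hD hA sDA)).trans
    (hBD.subset_of_isSmallInter hB hD (sDA.trans hA hB sAB))

section Translates

variable {n : ℕ} {H : Fin n → Subgroup G} {X : Fin n → Set G}

theorem mem_translates_iff :
    A ∈ translates X ↔ ∃ (i : Fin n) (b : Bool) (g : G), A = g • side (X i) b := by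
  simp only [translates, Set.mem_ofPred_eq, Bool.exists_bool, side, ← exists_or]
  exact exists_congr fun i => exists_congr fun g => or_comm

theorem compl_mem_translates (hA : A ∈ translates X) : Aᶜ ∈ translates X := by
  obtain ⟨i, g, rfl | rfl⟩ := hA
  · exact ⟨i, g, Or.inr Set.smul_set_compl.symm⟩
  · exact ⟨i, g, Or.inl (by rw [← Set.smul_set_compl, compl_compl])⟩

theorem isNontrivial_of_mem_translates (hX : ∀ i, IsNontrivialAlmostInvariant (H i) (X i))
    (hA : A ∈ translates X) : IsNontrivial A := by
  obtain ⟨i, g, rfl | rfl⟩ := hA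
  · exact ⟨_, (hX i).smul g⟩
  · exact ⟨_, (hX i).compl.smul g⟩

end Translates

end AlmostInclusion

/-! ### Pocsets and their ultrafilters -/

section Pocset

variable {α : Type*} {E U U' V V' W s : Set (Set α)} {r : Set α → Set α → Prop} {A : Set α}

/-- `E`, with the relation `r` and complementation, is a pocset: a partially ordered set with an
order-reversing involution for which no element lies below its own complement. Both inclusion and
almost inclusion make the set of translates a pocset. -/
structure IsPocset (E : Set (Set α)) (r : Set α → Set α → Prop) : Prop where
  compl_mem : ∀ A ∈ E, Aᶜ ∈ E
  refl : ∀ A ∈ E, r A A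
  antisymm : ∀ A ∈ E, ∀ B ∈ E, r A B → r B A → A = B
  trans : ∀ A ∈ E, ∀ B ∈ E, ∀ D ∈ E, r A B → r B D → r A D
  compl : ∀ A ∈ E, ∀ B ∈ E, r A B → r Bᶜ Aᶜ
  not_rel_compl : ∀ A ∈ E, ¬ r A Aᶜ

theorem IsPocset.exists_minimal (hE : IsPocset E r) (hsE : s ⊆ E) (hs : s.Finite)
    (hne : s.Nonempty) : ∃ A ∈ s, ∀ B ∈ s, r B A → B = A := by
  let lt : s → s → Prop := fun A B => r A B ∧ A ≠ B
  have _ : Finite s := hs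
  have _ : Std.Irrefl lt := ⟨fun _ h => h.2 rfl⟩
  have _ : IsTrans s lt := ⟨fun A B D hAB hBD => by
    refine ⟨hE.trans A (hsE A.2) B (hsE B.2) D (hsE D.2) hAB.1 hBD.1, ?_⟩
    rintro rfl
    exact hAB.2 (Subtype.ext (hE.antisymm A (hsE A.2) B (hsE B.2) hAB.1 hBD.1))⟩
  obtain ⟨A, -, hA⟩ := (Finite.wellFounded_of_trans_of_irrefl lt).has_min Set.univ
    (Set.nonempty_iff_univ_nonempty.mp hne.to_subtype)
  refine ⟨A, A.2, fun B hB hBA => ?_⟩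
  by_contra hne
  exact hA ⟨B, hB⟩ trivial ⟨hBA, fun h => hne (congrArg Subtype.val h)⟩

theorem IsUltrafilterOn.compl_mem_iff (hV : IsUltrafilterOn E r V) (hA : A ∈ E) :
    Aᶜ ∈ V ↔ A ∉ V := by
  have := hV.mem_xor A hA
  tauto

theorem IsUltrafilterOn.eq_of_subset (hV : IsUltrafilterOn E r V) (hV' : IsUltrafilterOn E r V')
    (h : V ⊆ V') : V = V' := by
  refine h.antisymm fun A hA => ?_
  by_contra hAV
  have hAE := hV'.subset hA
  exact (hV'.compl_mem_iff hAE).mp (h ((hV.compl_mem_iff hAE).mpr hAV)) hA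

theorem IsUltrafilterOn.flip (hE : IsPocset E r) (hV : IsUltrafilterOn E r V) (hA : A ∈ V)
    (hmin : ∀ B ∈ V, r B A → B = A) : IsUltrafilterOn E r (V \ {A} ∪ {Aᶜ}) := by
  have hAE := hV.subset hA
  have hAcV : Aᶜ ∉ V := fun h => (hV.compl_mem_iff hAE).mp h hA
  refine ⟨?_, fun B hB => ?_, fun B hB D hD hBD => ?_⟩
  · rintro B (hB | rfl)
    exacts [hV.subset hB.1, hE.compl_mem A hAE]
  · have hBV := hV.mem_xor B hB
    have hBcA : Bᶜ = A ↔ B = Aᶜ := compl_eq_comm.trans eq_comm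
    have hAA : B = A → B ≠ Aᶜ := fun h h' => hAcV (h' ▸ h ▸ hA)
    simp only [Set.mem_union, Set.mem_sdiff, Set.mem_singleton_iff, hBcA, compl_inj_iff]
    tauto
  · by_cases hDA : D = Aᶜ
    · exact Or.inr hDA
    rcases hB with ⟨hB, hBA⟩ | rfl
    · exact Or.inl ⟨hV.upward B hB D hD hBD, by rintro rfl; exact hBA (hmin B hB hBD)⟩
    · have hDcA : r Dᶜ A := by simpa using hE.compl _ (hE.compl_mem A hAE) D hD hBD
      refine Or.inl ⟨?_, ?_⟩
      · by_contra hDV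
        exact hDA (by rw [← hmin _ ((hV.compl_mem_iff hD).mpr hDV) hDcA, compl_compl])
      · rintro rfl
        exact hE.not_rel_compl _ (hE.compl_mem _ hAE) (by simpa using hBD)

theorem IsUltrafilterOn.minimal_of_minimal_sdiff (hV : IsUltrafilterOn E r V)
    (hV' : IsUltrafilterOn E r V') (hA : A ∈ V \ V') (hmin : ∀ B ∈ V \ V', r B A → B = A) :
    ∀ B ∈ V, r B A → B = A := fun B hB hBA =>
  hmin B ⟨hB, fun hB' => hA.2 (hV'.upward B hB' A (hV.subset hA.1) hBA)⟩ hBA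

theorem IsUltrafilterOn.flip_sdiff (hV' : IsUltrafilterOn E r V') (hA : A ∈ E) (hAV' : A ∉ V') :
    (V \ {A} ∪ {Aᶜ}) \ V' = (V \ V') \ {A} := by
  have hAc : ({Aᶜ} : Set (Set α)) \ V' = ∅ :=
    Set.sdiff_eq_empty.mpr (Set.singleton_subset_iff.mpr ((hV'.compl_mem_iff hA).mpr hAV'))
  rw [Set.union_sdiff_distrib, hAc, Set.union_empty, Set.sdiff_sdiff_comm]

/-- `U` is a partial ultrafilter: an upward closed subset of `E` that contains at most one of each
pair of complementary elements. These are the sets that occur during the completion of `U_1`. -/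
structure IsPartialUltrafilterOn (E : Set (Set α)) (r : Set α → Set α → Prop) (U : Set (Set α)) :
    Prop where
  subset : U ⊆ E
  upward : ∀ A ∈ U, ∀ B ∈ E, r A B → B ∈ U
  consistent : ∀ A ∈ U, Aᶜ ∉ U

theorem IsPartialUltrafilterOn.isUltrafilterOn (hU : IsPartialUltrafilterOn E r U)
    (hun : undecided E U = ∅) : IsUltrafilterOn E r U where
  subset := hU.subset
  mem_xor A hA := by
    refine ⟨?_, fun h => hU.consistent A h.1 h.2⟩
    by_contra! h
    exact Set.notMem_empty A (hun ▸ ⟨hA, h⟩)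
  upward := hU.upward

theorem IsPartialUltrafilterOn.union_above (hE : IsPocset E r)
    (hU : IsPartialUltrafilterOn E r U) (hA : A ∈ undecided E U) :
    IsPartialUltrafilterOn E r (U ∪ {B ∈ undecided E U | r A B}) where
  subset := Set.union_subset hU.subset fun _ hB => hB.1.1
  upward := by
    rintro B (hB | ⟨hB, hAB⟩) D hD hBD
    · exact Or.inl (hU.upward B hB D hD hBD)
    · have hAD := hE.trans A hA.1 B hB.1 D hD hAB hBD
      refine or_iff_not_imp_left.mpr fun hDU => ⟨⟨hD, hDU, fun hDc => hA.2.2 ?_⟩, hAD⟩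
      exact hU.upward _ hDc _ (hE.compl_mem A hA.1) (hE.compl A hA.1 D hD hAD)
  consistent := by
    rintro B (hB | ⟨hB, hAB⟩) (hBc | ⟨hBc, hABc⟩)
    · exact hU.consistent B hB hBc
    · exact hBc.2.2 ((compl_compl B).symm ▸ hB)
    · exact hB.2.2 hBc
    · have hBAc : r B Aᶜ := by simpa using hE.compl A hA.1 Bᶜ hBc.1 hABc
      exact hE.not_rel_compl A hA.1
        (hE.trans A hA.1 B hB.1 Aᶜ (hE.compl_mem A hA.1) hAB hBAc)

theorem CompletionStep.subset (h : CompletionStep E r U U') : U ⊆ U' := by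
  obtain ⟨A, -, -, rfl⟩ := h
  exact fun B hB => Or.inl (Or.inl hB)

theorem CompletionStep.undecided_ssubset (h : CompletionStep E r U U') :
    undecided E U' ⊂ undecided E U := by
  obtain ⟨A, hA, -, rfl⟩ := h
  exact ⟨fun B hB => ⟨hB.1, fun h => hB.2.1 (.inl (.inl h)), fun h => hB.2.2 (.inl (.inl h))⟩,
    fun h => (h hA).2.1 (.inl (.inr rfl))⟩

theorem CompletionStep.isPartialUltrafilterOn (hE : IsPocset E r)
    (h : CompletionStep E r U U') (hU : IsPartialUltrafilterOn E r U) :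
    IsPartialUltrafilterOn E r U' := by
  obtain ⟨A, hA, -, rfl⟩ := h
  have hAabove : {A} ⊆ {B ∈ undecided E U | r A B} :=
    Set.singleton_subset_iff.mpr ⟨hA, hE.refl A hA.1⟩
  rw [Set.union_assoc, Set.union_eq_self_of_subset_left hAabove]
  exact hU.union_above hE hA

theorem subset_of_reflTransGen_completionStep
    (h : Relation.ReflTransGen (CompletionStep E r) U W) : U ⊆ W := by
  induction h with
  | refl => exact subset_rfl
  | tail _ hstep ih => exact ih.trans hstep.subset

theorem IsPartialUltrafilterOn.of_reflTransGen_completionStep (hE : IsPocset E r)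
    (hU : IsPartialUltrafilterOn E r U) (h : Relation.ReflTransGen (CompletionStep E r) U W) :
    IsPartialUltrafilterOn E r W := by
  induction h with
  | refl => exact hU
  | tail _ hstep ih => exact hstep.isPartialUltrafilterOn hE ih

theorem IsPocset.exists_completion (hE : IsPocset E r) (hfin : (undecided E U).Finite) :
    ∃ W, Relation.ReflTransGen (CompletionStep E r) U W ∧ undecided E W = ∅ := by
  induction hN : (undecided E U).ncard using Nat.strong_induction_on generalizing U with
  | _ N ih =>
    rcases (undecided E U).eq_empty_or_nonempty with hempty | hne
    · exact ⟨U, .refl, hempty⟩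
    · obtain ⟨A, hA, hmin⟩ := hE.exists_minimal (fun _ hB => hB.1) hfin hne
      have hstep : CompletionStep E r U _ := ⟨A, hA, hmin, rfl⟩
      have hlt := hstep.undecided_ssubset
      obtain ⟨W, hW, hWun⟩ :=
        ih _ (hN ▸ Set.ncard_lt_ncard hlt hfin) (hfin.subset hlt.subset) rfl
      exact ⟨W, .head hstep hW, hWun⟩

end Pocset

/-! ### Components of the graph of ultrafilters -/

namespace CubingData

variable {G : Type*} [Group G] {D D' : CubingData G}

theorem reachable_of_finite_sdiff (hD : IsPocset D.E D.rel) (V V' : D.Ultra)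
    (hfin : (V.1 \ V'.1).Finite) : D.fullGraph.Reachable V V' := by
  induction hN : (V.1 \ V'.1).ncard using Nat.strong_induction_on generalizing V with
  | _ N ih =>
    rcases (V.1 \ V'.1).eq_empty_or_nonempty with hempty | hne
    · rw [Subtype.ext (V.2.eq_of_subset V'.2 (Set.sdiff_eq_empty.mp hempty))]
    · have hsub : V.1 \ V'.1 ⊆ D.E := Set.sdiff_subset.trans V.2.subset
      obtain ⟨A, hA, hmin⟩ := hD.exists_minimal hsub hfin hne
      let V₁ : D.Ultra := ⟨V.1 \ {A} ∪ {Aᶜ},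
        V.2.flip hD hA.1 (V.2.minimal_of_minimal_sdiff V'.2 hA hmin)⟩
      have hadj : D.fullGraph.Adj V V₁ := ⟨A, hA.1, rfl⟩
      have hsdiff : V₁.1 \ V'.1 = (V.1 \ V'.1) \ {A} := V'.2.flip_sdiff (hsub hA) hA.2
      refine hadj.reachable.trans (ih (V₁.1 \ V'.1).ncard ?_ V₁ ?_ rfl)
      · rw [hsdiff, ← hN]
        exact Set.ncard_sdiff_singleton_lt_of_mem hA hfin
      · exact hsdiff ▸ hfin.subset Set.sdiff_subset

theorem exists_reachable_mk (v : D.Vertex) {w : D.Ultra} (h : D.fullGraph.Reachable v.1 w) :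
    ∃ hw, D.graph.Reachable v ⟨w, hw⟩ := by
  rw [SimpleGraph.reachable_iff_reflTransGen] at h
  induction h with
  | refl => exact ⟨v.2, SimpleGraph.Reachable.refl _⟩
  | @tail b c _ hbc ih =>
    obtain ⟨⟨W, hW, hWb⟩, hvb⟩ := ih
    have hadj : D.graph.Adj ⟨b, W, hW, hWb⟩ ⟨c, W, hW, hWb.trans hbc.reachable⟩ := hbc
    exact ⟨_, hvb.trans hadj.reachable⟩

theorem graph_connected (hD : IsPocset D.E D.rel) (hne : ∃ W : D.Ultra, W.1 ∈ D.basic)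
    (hfin : ∀ W ∈ D.basic, ∀ W' ∈ D.basic, (W \ W').Finite) : D.graph.Connected := by
  obtain ⟨W₀, hW₀⟩ := hne
  rw [SimpleGraph.connected_iff]
  refine ⟨fun v w => ?_, ⟨⟨W₀, W₀, hW₀, SimpleGraph.Reachable.refl _⟩⟩⟩
  obtain ⟨W, hW, hWv⟩ := v.2
  obtain ⟨W', hW', hWw⟩ := w.2
  have hWW' := reachable_of_finite_sdiff hD W W' (hfin W hW W' hW')
  exact (exists_reachable_mk v (hWv.symm.trans (hWW'.trans hWw))).2

/-- The inclusion of the ultrafilters for a finer order in those for a coarser one. -/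
def ultraInclusion (h : ∀ V, IsUltrafilterOn D.E D.rel V → IsUltrafilterOn D'.E D'.rel V) :
    D.fullGraph ↪g D'.fullGraph where
  toFun V := ⟨V.1, h V.1 V.2⟩
  inj' _ _ hV := Subtype.ext (congrArg (fun W : D'.Ultra => W.1) hV)
  map_rel_iff' := Iff.rfl

/-- The restriction of `ultraInclusion` to the vertices that are connected to the basic ones,
provided that the basic vertices of `D` are connected to those of `D'`. -/
def vertexInclusion (h : ∀ V, IsUltrafilterOn D.E D.rel V → IsUltrafilterOn D'.E D'.rel V)
    (hb : ∀ W : D.Ultra, W.1 ∈ D.basic →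
      ∃ W' : D'.Ultra, W'.1 ∈ D'.basic ∧ D'.fullGraph.Reachable W' (ultraInclusion h W)) :
    D.graph ↪g D'.graph where
  toFun V := ⟨ultraInclusion h V.1, by
    obtain ⟨W, hW, hWV⟩ := V.2
    obtain ⟨W', hW', hWW'⟩ := hb W hW
    exact ⟨W', hW', hWW'.trans (hWV.map (ultraInclusion h).toHom)⟩⟩
  inj' _ _ hV := Subtype.ext ((ultraInclusion h).injective (congrArg Subtype.val hV))
  map_rel_iff' := Iff.rfl

theorem realizationMap_smul (f : D.graph.Copy D'.graph)
    (hf : ∀ (g : G) (V : D.Vertex), f (D.act g V) = D'.act g (f V)) (g : G) (x : D.Complex) :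
    Realization.map f (g • x) = g • (show D'.Complex from Realization.map f x) :=
  (Realization.map_map (D.act g) f (f.comp (D.act g)) (fun _ => rfl) x).trans
    (Realization.map_map f (D'.act g) (f.comp (D.act g)) (hf g) x).symm

end CubingData

/-! ### Faces of cubes -/

section Faces

universe u

variable {V : Type u} {Γ : SimpleGraph V} {k l m n : ℕ}

theorem isCube_one_iff {φ : (Fin 1 → Bool) → V} :
    IsCube Γ 1 φ ↔
      Function.Injective φ ∧ ∀ y i, Γ.Adj (φ y) (φ (Function.update y i (!y i))) := by
  have hconst (y : Fin 1 → Bool) : y = fun _ => y 0 := funext fun i => by rw [Subsingleton.elim i 0]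
  have hadj (h : IsCube Γ 1 φ) : ∀ b : Bool, Γ.Adj (φ fun _ => b) (φ fun _ => !b)
    | false => h
    | true => h.symm
  simp only [Function.update_eq_const_of_subsingleton]
  refine ⟨fun h => ⟨fun y y' hyy' => ?_, fun y i => ?_⟩, fun h => h.2 (fun _ => false) 0⟩
  · rw [hconst y, hconst y'] at hyy' ⊢
    by_contra hne
    have hy' : y' 0 = !y 0 := Bool.eq_not_of_ne fun h0 => hne (by rw [h0])
    rw [hy'] at hyy'
    exact (hadj h (y 0)).ne hyy'
  · rw [Subsingleton.elim i 0, hconst y]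
    exact hadj h (y 0)

theorem isCube_iff : ∀ {n : ℕ} {φ : (Fin n → Bool) → V}, IsCube Γ n φ ↔
    Function.Injective φ ∧ ∀ y i, Γ.Adj (φ y) (φ (Function.update y i (!y i)))
  | 0, φ => by
    simp only [IsCube, true_iff]
    exact ⟨Function.injective_of_subsingleton _, fun _ i => i.elim0⟩
  | 1, φ => isCube_one_iff
  | n + 2, φ => by
    refine and_congr_right fun hφ => ⟨fun h y i => ?_, fun h i b => isCube_iff.mpr ⟨?_, ?_⟩⟩
    · obtain ⟨k, hk⟩ := exists_ne i
      obtain ⟨j, rfl⟩ := Fin.exists_succAbove_eq hk.symm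
      have hadj := (isCube_iff.mp (h k (y k))).2 (k.removeNth y) j
      rwa [Fin.insertNth_update, Fin.insertNth_self_removeNth] at hadj
    · exact hφ.comp (Fin.insertNth_right_injective (α := fun _ => Bool) b)
    · intro y j
      have hadj := h (i.insertNth b y) (i.succAbove j)
      rwa [Fin.insertNth_apply_succAbove, ← Fin.insertNth_update] at hadj

/-- The isometry of `[0,1]` that reverses the interval if `b` is `true`; on the end points `0` and
`1` it is `xor b`. It describes a single coordinate of `facePoint`. -/
def reflect (b : Bool) (t : unitInterval) : unitInterval :=
  if b then unitInterval.symm t else t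

theorem reflect_xor (b b' : Bool) (t : unitInterval) :
    reflect (xor b b') t = reflect b (reflect b' t) := by
  cases b <;> cases b' <;> simp [reflect]

theorem reflect_reflect (b : Bool) (t : unitInterval) : reflect b (reflect b t) = t := by
  rw [← reflect_xor, Bool.xor_self]
  rfl

theorem reflect_injective (b : Bool) : Function.Injective (reflect b) :=
  Function.LeftInverse.injective (reflect_reflect b)

theorem reflect_zero_inj {b b' : Bool} : reflect b 0 = reflect b' 0 ↔ b = b' := by
  cases b <;> cases b' <;> simp [reflect]

theorem continuous_reflect (b : Bool) : Continuous (reflect b) := by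
  cases b
  · exact continuous_id
  · exact unitInterval.continuous_symm

theorem faceVertex_apply (e : Fin m ↪ Fin n) (c : Fin n → Bool) (x : Fin m → Bool) (i : Fin m) :
    faceVertex e c x (e i) = xor (c (e i)) (x i) := by
  rw [faceVertex, e.injective.extend_apply]

theorem faceVertex_of_notMem {e : Fin m ↪ Fin n} {j : Fin n} (hj : j ∉ Set.range e)
    (c : Fin n → Bool) (x : Fin m → Bool) : faceVertex e c x j = c j := by
  rw [faceVertex, Function.extend_apply' _ _ _ hj, Bool.xor_false]

theorem facePoint_apply (e : Fin m ↪ Fin n) (c : Fin n → Bool) (x : Fin m → unitInterval)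
    (i : Fin m) : facePoint e c x (e i) = reflect (c (e i)) (x i) := by
  rw [facePoint, e.injective.extend_apply, reflect]

theorem facePoint_of_notMem {e : Fin m ↪ Fin n} {j : Fin n} (hj : j ∉ Set.range e)
    (c : Fin n → Bool) (x : Fin m → unitInterval) : facePoint e c x j = reflect (c j) 0 := by
  rw [facePoint, Function.extend_apply' _ _ _ hj, reflect]

theorem faceVertex_injective (e : Fin m ↪ Fin n) (c : Fin n → Bool) :
    Function.Injective (faceVertex e c) := by
  intro x y h
  funext i
  simpa [faceVertex_apply] using congrFun h (e i)

theorem facePoint_injective (e : Fin m ↪ Fin n) (c : Fin n → Bool) :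
    Function.Injective (facePoint e c) := by
  intro x y h
  funext i
  have hi := congrFun h (e i)
  rw [facePoint_apply, facePoint_apply] at hi
  exact reflect_injective _ hi

theorem continuous_facePoint (e : Fin m ↪ Fin n) (c : Fin n → Bool) :
    Continuous (facePoint e c) := by
  refine continuous_pi fun j => ?_
  by_cases hj : j ∈ Set.range e
  · obtain ⟨i, rfl⟩ := hj
    simp only [facePoint_apply]
    exact (continuous_reflect _).comp (continuous_apply i)
  · simp only [facePoint_of_notMem hj]
    exact continuous_const

theorem mem_range_faceVertex_iff {e : Fin m ↪ Fin n} {c d : Fin n → Bool} :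
    d ∈ Set.range (faceVertex e c) ↔ ∀ j ∉ Set.range e, d j = c j := by
  constructor
  · rintro ⟨x, rfl⟩ j hj
    exact faceVertex_of_notMem hj c x
  · refine fun h => ⟨fun i => xor (c (e i)) (d (e i)), funext fun j => ?_⟩
    by_cases hj : j ∈ Set.range e
    · obtain ⟨i, rfl⟩ := hj
      rw [faceVertex_apply, ← Bool.xor_assoc, Bool.xor_self, Bool.false_xor]
    · rw [faceVertex_of_notMem hj, h j hj]

theorem mem_range_facePoint_iff {e : Fin m ↪ Fin n} {c : Fin n → Bool} {p : Fin n → unitInterval} :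
    p ∈ Set.range (facePoint e c) ↔ ∀ j ∉ Set.range e, p j = reflect (c j) 0 := by
  constructor
  · rintro ⟨x, rfl⟩ j hj
    exact facePoint_of_notMem hj c x
  · refine fun h => ⟨fun i => reflect (c (e i)) (p (e i)), funext fun j => ?_⟩
    by_cases hj : j ∈ Set.range e
    · obtain ⟨i, rfl⟩ := hj
      rw [facePoint_apply, reflect_reflect]
    · rw [facePoint_of_notMem hj, h j hj]

theorem faceVertex_update (e : Fin m ↪ Fin n) (c : Fin n → Bool) (x : Fin m → Bool) (i : Fin m) :
    faceVertex e c (Function.update x i (!x i))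
      = Function.update (faceVertex e c x) (e i) (!faceVertex e c x (e i)) := by
  funext j
  by_cases hj : j ∈ Set.range e
  · obtain ⟨l, rfl⟩ := hj
    rcases eq_or_ne l i with rfl | hl
    · simp [faceVertex_apply]
    · simp [faceVertex_apply, hl, e.injective.ne hl]
  · have hj' : j ≠ e i := fun h => hj ⟨i, h.symm⟩
    rw [Function.update_of_ne hj', faceVertex_of_notMem hj, faceVertex_of_notMem hj]

theorem IsCube.face {φ : (Fin n → Bool) → V} (h : IsCube Γ n φ) (e : Fin m ↪ Fin n)
    (c : Fin n → Bool) : IsCube Γ m fun y => φ (faceVertex e c y) := by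
  rw [isCube_iff] at h ⊢
  refine ⟨h.1.comp (faceVertex_injective e c), fun y i => ?_⟩
  rw [faceVertex_update]
  exact h.2 _ _

theorem apply_notMem_range_trans (e : Fin m ↪ Fin n) {e' : Fin k ↪ Fin m} {i : Fin m}
    (hi : i ∉ Set.range e') : e i ∉ Set.range (e'.trans e) :=
  fun ⟨a, ha⟩ => hi ⟨a, e.injective ha⟩

theorem faceVertex_comp (e : Fin m ↪ Fin n) (c : Fin n → Bool) (e' : Fin k ↪ Fin m)
    (c' : Fin m → Bool) (y : Fin k → Bool) :
    faceVertex e c (faceVertex e' c' y) = faceVertex (e'.trans e) (faceVertex e c c') y := by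
  funext j
  by_cases hj : j ∈ Set.range e
  · obtain ⟨i, rfl⟩ := hj
    rw [faceVertex_apply]
    by_cases hi : i ∈ Set.range e'
    · obtain ⟨a, rfl⟩ := hi
      have ha := faceVertex_apply (e'.trans e) (faceVertex e c c') y a
      rw [Function.Embedding.trans_apply, faceVertex_apply e c] at ha
      rw [ha, faceVertex_apply, Bool.xor_assoc]
    · rw [faceVertex_of_notMem hi, faceVertex_of_notMem (apply_notMem_range_trans e hi),
        faceVertex_apply]
  · have hj' : j ∉ Set.range (e'.trans e) := fun ⟨a, ha⟩ => hj ⟨e' a, ha⟩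
    simp only [faceVertex_of_notMem hj, faceVertex_of_notMem hj']

theorem facePoint_comp (e : Fin m ↪ Fin n) (c : Fin n → Bool) (e' : Fin k ↪ Fin m)
    (c' : Fin m → Bool) (y : Fin k → unitInterval) :
    facePoint e c (facePoint e' c' y) = facePoint (e'.trans e) (faceVertex e c c') y := by
  funext j
  by_cases hj : j ∈ Set.range e
  · obtain ⟨i, rfl⟩ := hj
    rw [facePoint_apply]
    by_cases hi : i ∈ Set.range e'
    · obtain ⟨a, rfl⟩ := hi
      have ha := facePoint_apply (e'.trans e) (faceVertex e c c') y a
      rw [Function.Embedding.trans_apply, faceVertex_apply e c] at ha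
      rw [ha, facePoint_apply, reflect_xor]
    · rw [facePoint_of_notMem hi, facePoint_of_notMem (apply_notMem_range_trans e hi),
        faceVertex_apply, reflect_xor]
  · have hj' : j ∉ Set.range (e'.trans e) := fun ⟨a, ha⟩ => hj ⟨e' a, ha⟩
    rw [facePoint_of_notMem hj, facePoint_of_notMem hj', faceVertex_of_notMem hj]

theorem faceVertex_refl (y : Fin n → Bool) :
    faceVertex (Function.Embedding.refl _) (fun _ => false) y = y :=
  funext fun j =>
    (faceVertex_apply (Function.Embedding.refl _) (fun _ => false) y j).trans (Bool.false_xor _)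

theorem facePoint_refl (y : Fin n → unitInterval) :
    facePoint (Function.Embedding.refl _) (fun _ => false) y = y :=
  funext fun j => facePoint_apply (Function.Embedding.refl _) (fun _ => false) y j

theorem exists_embedding_pullback (e : Fin m ↪ Fin n) (e' : Fin l ↪ Fin n) :
    ∃ (k : ℕ) (a : Fin k ↪ Fin m) (a' : Fin k ↪ Fin l), a.trans e = a'.trans e' ∧
      Set.range (a.trans e) = Set.range e ∩ Set.range e' := by
  classical
  let K : Finset (Fin n) := {j | j ∈ Set.range e ∩ Set.range e'}
  let f : Fin K.card ↪ Fin n := (K.orderEmbOfFin rfl).toEmbedding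
  have hf : Set.range f = Set.range e ∩ Set.range e' := by
    refine (Finset.range_orderEmbOfFin K rfl).trans ?_
    simp [K, Set.ext_iff]
  have hmem (i) : f i ∈ Set.range e ∩ Set.range e' := hf ▸ Set.mem_range_self i
  choose a ha using fun i => (hmem i).1
  choose a' ha' using fun i => (hmem i).2
  have ha_inj : Function.Injective a := fun i i' h => f.injective (by rw [← ha, ← ha, h])
  have ha'_inj : Function.Injective a' := fun i i' h => f.injective (by rw [← ha', ← ha', h])
  have hae : (⟨a, ha_inj⟩ : Fin K.card ↪ Fin m).trans e = f := Function.Embedding.ext ha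
  have hae' : (⟨a', ha'_inj⟩ : Fin K.card ↪ Fin l).trans e' = f := Function.Embedding.ext ha'
  exact ⟨K.card, ⟨a, ha_inj⟩, ⟨a', ha'_inj⟩, hae.trans hae'.symm, hae ▸ hf⟩

theorem exists_common_face {e : Fin m ↪ Fin n} {c : Fin n → Bool} {x : Fin m → unitInterval}
    {e' : Fin l ↪ Fin n} {c' : Fin n → Bool} {x' : Fin l → unitInterval}
    (h : facePoint e c x = facePoint e' c' x') :
    ∃ (k : ℕ) (a : Fin k ↪ Fin m) (b : Fin m → Bool) (a' : Fin k ↪ Fin l) (b' : Fin l → Bool)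
      (z : Fin k → unitInterval), facePoint a b z = x ∧ facePoint a' b' z = x' ∧
        ∀ y, faceVertex e c (faceVertex a b y) = faceVertex e' c' (faceVertex a' b' y) := by
  classical
  obtain ⟨k, a, a', haa', hrange⟩ := exists_embedding_pullback e e'
  have hx' {j} (hj : j ∉ Set.range e') : facePoint e c x j = reflect (c' j) 0 :=
    h ▸ facePoint_of_notMem hj c' x'
  have hx {j} (hj : j ∉ Set.range e) : facePoint e c x j = reflect (c j) 0 :=
    facePoint_of_notMem hj c x
  -- The common face consists of the points that agree with `d` off the range of `a.trans e`.
  let d : Fin n → Bool := fun j => if j ∈ Set.range e then c' j else c j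
  have hd {j} (hj : j ∉ Set.range e) : d j = c j := if_neg hj
  have hd' {j} (hj : j ∉ Set.range e') : d j = c' j := by
    by_cases hje : j ∈ Set.range e
    · exact if_pos hje
    · rw [hd hje, ← reflect_zero_inj, ← hx hje, hx' hj]
  obtain ⟨b, hb⟩ := mem_range_faceVertex_iff.mpr fun j => hd (j := j)
  obtain ⟨b', hb'⟩ := mem_range_faceVertex_iff.mpr fun j => hd' (j := j)
  obtain ⟨z, hz⟩ : facePoint e c x ∈ Set.range (facePoint (a.trans e) d) := by
    refine mem_range_facePoint_iff.mpr fun j hj => ?_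
    rcases not_and_or.mp (hrange ▸ hj) with hj | hj
    · rw [hx hj, hd hj]
    · rw [hx' hj, hd' hj]
  refine ⟨k, a, b, a', b', z, facePoint_injective e c ?_, facePoint_injective e' c' ?_,
    fun y => ?_⟩
  · rw [facePoint_comp, hb, hz]
  · rw [facePoint_comp, hb', ← haa', hz, h]
  · rw [faceVertex_comp, faceVertex_comp, hb, hb', haa']

end Faces

/-! ### Subcomplexes -/

section Embedding

universe u v

variable {V : Type u} {V' : Type v} {Γ : SimpleGraph V} {Γ' : SimpleGraph V'} {m n : ℕ}

/-- The point `x` of the cube `σ` of `Γ'` lies in a face that is the image under `f` of a cube of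
`Γ`, and `a` is the corresponding point of the realization of `Γ`. This describes the fibres of
`Realization.map f` inside a single cube, without reference to the generated equivalence. -/
def FaceLift (f : Γ.Copy Γ') (σ : Cell Γ') (x : Fin σ.1 → unitInterval) (a : Realization Γ) :
    Prop :=
  ∃ (m : ℕ) (ψ : {ψ : (Fin m → Bool) → V // IsCube Γ m ψ}) (e : Fin m ↪ Fin σ.1)
    (c : Fin σ.1 → Bool) (y : Fin m → unitInterval),
    (∀ w, f (ψ.1 w) = σ.2.1 (faceVertex e c w)) ∧ facePoint e c y = x ∧
      a = Quot.mk _ ⟨⟨m, ψ⟩, y⟩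

theorem faceLift_map (f : Γ.Copy Γ') (σ : Cell Γ) (x : Fin σ.1 → unitInterval) :
    FaceLift f (σ.map f) x (Quot.mk _ ⟨σ, x⟩) :=
  ⟨σ.1, σ.2, Function.Embedding.refl _, fun _ => false, x,
    fun w => congrArg (fun w => f (σ.2.1 w)) (faceVertex_refl w).symm, facePoint_refl _, rfl⟩

theorem FaceLift.map_eq_mk {f : Γ.Copy Γ'} {σ : Cell Γ'} {x : Fin σ.1 → unitInterval}
    {a : Realization Γ} (h : FaceLift f σ x a) : Realization.map f a = Quot.mk _ ⟨σ, x⟩ := by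
  obtain ⟨m, ψ, e, c, y, hv, rfl, rfl⟩ := h
  exact Quot.sound (Glue.face ⟨fun w => f (ψ.1 w), ψ.2.map f⟩ σ.2 e c hv y)

theorem FaceLift.eq_mk {f : Γ.Copy Γ'} {σ : Cell Γ} {x : Fin σ.1 → unitInterval}
    {a : Realization Γ} (h : FaceLift f (σ.map f) x a) : a = Quot.mk _ ⟨σ, x⟩ := by
  obtain ⟨m, ψ, e, c, y, hv, rfl, rfl⟩ := h
  exact Quot.sound (Glue.face ψ σ.2 e c (fun w => f.injective (hv w)) y)

theorem faceLift_iff_of_glue (f : Γ.Copy Γ') {p q : CubePoint Γ'} (h : Glue Γ' p q)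
    (a : Realization Γ) : FaceLift f p.1 p.2 a ↔ FaceLift f q.1 q.2 a := by
  obtain ⟨ψ', φ', e', c', hψ', x⟩ := h
  constructor
  · rintro ⟨m, ψ, e, c, y, hv, hy, rfl⟩
    refine ⟨m, ψ, e.trans e', faceVertex e' c' c, y, fun w => ?_, ?_, rfl⟩
    · exact (hv w).trans ((hψ' _).trans (congrArg φ'.1 (faceVertex_comp e' c' e c w)))
    · exact (facePoint_comp e' c' e c y).symm.trans (congrArg (facePoint e' c') hy)
  · rintro ⟨m, ψ, e, c, y, hv, hy, rfl⟩
    obtain ⟨k, e₂, c₂, e₁, c₁, z, rfl, hx, hw⟩ := exists_common_face hy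
    refine ⟨k, ⟨_, ψ.2.face e₂ c₂⟩, e₁, c₁, z, fun w => ?_, hx, ?_⟩
    · simp only [hv, hw, hψ']
    · exact (Quot.sound (Glue.face ⟨_, ψ.2.face e₂ c₂⟩ ψ e₂ c₂ (fun _ => rfl) z)).symm

theorem mk_eq_map_iff (f : Γ.Copy Γ') (σ : Cell Γ') (x : Fin σ.1 → unitInterval)
    (a : Realization Γ) : Quot.mk _ ⟨σ, x⟩ = Realization.map f a ↔ FaceLift f σ x a := by
  refine ⟨fun h => ?_, fun h => h.map_eq_mk.symm⟩
  have hinv {p q : CubePoint Γ'} (hpq : Relation.EqvGen (Glue Γ') p q) :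
      FaceLift f p.1 p.2 a ↔ FaceLift f q.1 q.2 a := by
    induction hpq with
    | rel _ _ h => exact faceLift_iff_of_glue f h a
    | refl => rfl
    | symm _ _ _ ih => exact ih.symm
    | trans _ _ _ _ _ ih ih' => exact ih.trans ih'
  induction a using Quot.inductionOn with | _ q
  exact (hinv (Quot.eqvGen_exact h)).mpr (faceLift_map f q.1 q.2)

theorem realizationMap_injective (f : Γ.Copy Γ') : Function.Injective (Realization.map f) := by
  intro a b h
  induction b using Quot.inductionOn with | _ q
  exact ((mk_eq_map_iff f (q.1.map f) q.2 a).mp h.symm).eq_mk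

theorem continuous_realizationMap (f : Γ.Copy Γ') : Continuous (Realization.map f) :=
  continuous_quot_lift _ <| continuous_quot_mk.comp <| continuous_sigma fun σ =>
    continuous_sigmaMk (σ := fun σ : Cell Γ' => Fin σ.1 → unitInterval) (i := σ.map f)

theorem isClosed_setOf_exists_lift (f : Γ.Copy Γ') {A : Set (Realization Γ)} (hA : IsClosed A)
    (φ : (Fin n → Bool) → V') (e : Fin m ↪ Fin n) (c : Fin n → Bool) :
    IsClosed {x | ∃ ψ : {ψ : (Fin m → Bool) → V // IsCube Γ m ψ},
      (∀ w, f (ψ.1 w) = φ (faceVertex e c w)) ∧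
        x ∈ facePoint e c '' {y | Quot.mk (Glue Γ) ⟨⟨m, ψ⟩, y⟩ ∈ A}} := by
  -- By injectivity of `f`, at most one cube `ψ` contributes.
  let Ψ : Set {ψ : (Fin m → Bool) → V // IsCube Γ m ψ} :=
    {ψ | ∀ w, f (ψ.1 w) = φ (faceVertex e c w)}
  have hΨ : Ψ.Subsingleton := fun ψ hψ ψ' hψ' =>
    Subtype.ext (funext fun w => f.injective ((hψ w).trans (hψ' w).symm))
  have hA' := isClosed_sigma_iff.mp (hA.preimage continuous_quot_mk)
  convert hΨ.finite.isClosed_biUnion fun ψ _ =>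
    (continuous_facePoint e c).isClosedMap _ (hA' ⟨m, ψ⟩) using 1
  ext x
  simp only [Set.mem_iUnion, exists_prop]
  rfl

theorem mk_mem_map_image_iff (f : Γ.Copy Γ') {A : Set (Realization Γ)}
    (φ : {φ : (Fin n → Bool) → V' // IsCube Γ' n φ}) (x : Fin n → unitInterval) :
    Quot.mk (Glue Γ') ⟨⟨n, φ⟩, x⟩ ∈ Realization.map f '' A ↔
      ∃ (m : Fin (n + 1)) (e : Fin m ↪ Fin n) (c : Fin n → Bool)
        (ψ : {ψ : (Fin m → Bool) → V // IsCube Γ m ψ}),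
        (∀ w, f (ψ.1 w) = φ.1 (faceVertex e c w)) ∧
          x ∈ facePoint e c '' {y | Quot.mk (Glue Γ) ⟨⟨m, ψ⟩, y⟩ ∈ A} := by
  constructor
  · rintro ⟨a, ha, hax⟩
    obtain ⟨m, ψ, e, c, y, hv, hy, rfl⟩ := (mk_eq_map_iff f ⟨n, φ⟩ x a).mp hax.symm
    have hm : m ≤ n := by simpa using Fintype.card_le_of_embedding e
    exact ⟨⟨m, Nat.lt_succ_of_le hm⟩, e, c, ψ, hv, y, ha, hy⟩
  · rintro ⟨m, e, c, ψ, hv, y, ha, hy⟩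
    exact ⟨_, ha, FaceLift.map_eq_mk (σ := ⟨n, φ⟩) ⟨m, ψ, e, c, y, hv, hy, rfl⟩⟩

theorem isClosedMap_realizationMap (f : Γ.Copy Γ') : IsClosedMap (Realization.map f) := by
  intro A hA
  refine isQuotientMap_quot_mk.isClosed_preimage.mp (isClosed_sigma_iff.mpr ?_)
  rintro ⟨n, φ⟩
  have hpieces : IsClosed (⋃ (m : Fin (n + 1)) (e : Fin m ↪ Fin n) (c : Fin n → Bool), _) :=
    isClosed_iUnion_of_finite fun _ => isClosed_iUnion_of_finite fun e =>
      isClosed_iUnion_of_finite fun c => isClosed_setOf_exists_lift f hA φ.1 e c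
  convert hpieces using 1
  ext x
  simp only [Set.mem_iUnion]
  exact mk_mem_map_image_iff f φ x

theorem isClosedEmbedding_realizationMap (f : Γ.Copy Γ') :
    Topology.IsClosedEmbedding (Realization.map f) :=
  .of_continuous_injective_isClosedMap (continuous_realizationMap f)
    (realizationMap_injective f) (isClosedMap_realizationMap f)

end Embedding

/-! ### Boundaries in the Cayley graph -/

section Boundary

variable {G : Type*} [Group G] {S : Set G}

/-- The set of endpoints of the edges of the coboundary `δA`. A statement that `δA` meets or avoids
a set of vertices becomes one about `boundary S A`. -/
def boundary (S A : Set G) : Set G := {v | ∃ e ∈ coboundary S A, v ∈ e}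

theorem mem_boundary_iff {A : Set G} {v : G} :
    v ∈ boundary S A ↔ ∃ w, (SimpleGraph.mulCayley S).Adj v w ∧ ¬ (v ∈ A ↔ w ∈ A) := by
  constructor
  · rintro ⟨_, ⟨a, ha, b, hb, hab, rfl⟩, hv⟩
    rcases Sym2.mem_iff.mp hv with rfl | rfl
    · exact ⟨b, hab, fun h => hb (h.mp ha)⟩
    · exact ⟨a, hab.symm, fun h => hb (h.mpr ha)⟩
  · rintro ⟨w, hvw, h⟩
    by_cases hv : v ∈ A
    · exact ⟨s(v, w), ⟨v, hv, w, fun hw => h (iff_of_true hv hw), hvw, rfl⟩, Sym2.mem_mk_left v w⟩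
    · have hw : w ∈ A := by_contra fun hw => h (iff_of_false hv hw)
      exact ⟨s(w, v), ⟨w, hw, v, hv, hvw.symm, rfl⟩, Sym2.mem_mk_right w v⟩

@[simp]
theorem boundary_compl (A : Set G) : boundary S Aᶜ = boundary S A := by
  ext v
  simp only [mem_boundary_iff, Set.mem_compl_iff, not_iff_not]

theorem boundary_side (A : Set G) : ∀ b : Bool, boundary S (side A b) = boundary S A
  | true => rfl
  | false => boundary_compl A

theorem boundary_smul (k : G) (A : Set G) : boundary S (k • A) = k • boundary S A := by
  ext v
  simp only [mem_boundary_iff, Set.mem_smul_set_iff_inv_smul_mem, smul_eq_mul]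
  refine ⟨fun ⟨w, hvw, h⟩ => ⟨k⁻¹ * w, mulCayley_adj_smul S k⁻¹ hvw, h⟩, fun ⟨w, hvw, h⟩ => ?_⟩
  exact ⟨k * w, by simpa using mulCayley_adj_smul S k hvw, by simpa using h⟩

theorem mem_iff_of_forall_support_notMem_boundary {A : Set G} {g h : G}
    (p : (SimpleGraph.mulCayley S).Walk g h) (hp : ∀ v ∈ p.support, v ∉ boundary S A) :
    g ∈ A ↔ h ∈ A := by
  induction p with
  | nil => rfl
  | cons hadj q ih =>
    have hstep := not_not.mp fun h => hp _ (by simp) (mem_boundary_iff.mpr ⟨_, hadj, h⟩)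
    exact hstep.trans (ih fun v hv => hp v (by simp [hv]))

theorem exists_eq_mul_of_mulCayley_adj {v w : G} (h : (SimpleGraph.mulCayley S).Adj v w) :
    ∃ s ∈ S ∪ S⁻¹, w = v * s := by
  rw [SimpleGraph.mulCayley_adj] at h
  rcases h.2 with h | h
  · exact ⟨_, Or.inl h, by simp⟩
  · exact ⟨v⁻¹ * w, Or.inr (by simpa using h), by simp⟩

theorem IsAlmostInvariant.isHFinite_boundary {H : Subgroup G} {X : Set G}
    (hX : IsAlmostInvariant H X) (hS : S.Finite) : IsHFinite H (boundary S X) := by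
  refine (IsHFinite.biUnion (hS.union hS.inv) fun s _ =>
    (hX.isHFinite_mul_notMem s).union (hX.compl.isHFinite_mul_notMem s)).mono fun v hv => ?_
  obtain ⟨w, hvw, h⟩ := mem_boundary_iff.mp hv
  obtain ⟨s, hs, rfl⟩ := exists_eq_mul_of_mulCayley_adj hvw
  refine Set.mem_biUnion hs ?_
  by_cases hvX : v ∈ X
  · exact Or.inl ⟨hvX, fun hvs => h (iff_of_true hvX hvs)⟩
  · exact Or.inr ⟨hvX, fun hvs => h (iff_of_false hvX hvs)⟩

theorem IsAlmostInvariant.side {H : Subgroup G} {X : Set G} (hX : IsAlmostInvariant H X) :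
    ∀ b : Bool, IsAlmostInvariant H (side X b)
  | true => hX
  | false => hX.compl

/-- A translate `k • X` depends only on the coset `k H`, that is, on the coset `H k⁻¹`. -/
theorem IsAlmostInvariant.finite_smul {H : Subgroup G} {X Z : Set G} (hX : IsAlmostInvariant H X)
    (hZ : IsHFinite H Z) (v : G) : {A | ∃ k : G, A = k • X ∧ k⁻¹ * v ∈ Z}.Finite := by
  obtain ⟨F, hF, hZF⟩ := hZ
  refine (hF.image fun f => (v * f⁻¹) • X).subset ?_
  rintro _ ⟨k, rfl, hk⟩
  obtain ⟨h, hh, f, hf, hkf⟩ := hZF hk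
  have hv : v * f⁻¹ = k * h := by
    rw [mul_inv_eq_iff_eq_mul, mul_assoc, ← inv_mul_eq_iff_eq_mul]
    exact hkf.symm
  exact ⟨f, hf, by simp only [hv, mul_smul, hX.smul_eq hh]⟩

end Boundary

/-! ### Finitely many elements of `E` separate two points or cross a ball -/

section Ball

variable {G : Type*} [Group G] {S : Set G} {R N : ℕ} {g h : G} {A : Set G}

theorem exists_walk_of_mem_ball (hh : h ∈ ball S R g) :
    ∃ p : (SimpleGraph.mulCayley S).Walk g h, p.length ≤ R := by
  have hh' : (SimpleGraph.mulCayley S).edist g h ≤ R := hh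
  obtain ⟨p, hp⟩ := SimpleGraph.exists_walk_of_edist_ne_top
    (ne_top_of_le_ne_top (ENat.natCast_ne_top R) hh')
  exact ⟨p, by exact_mod_cast hp ▸ hh'⟩

theorem mem_ball_of_mem_support {p : (SimpleGraph.mulCayley S).Walk g h} (hp : p.length ≤ R)
    {v : G} (hv : v ∈ p.support) : v ∈ ball S R g := by
  classical
  have hle := (p.length_takeUntil_le_length hv).trans hp
  exact (SimpleGraph.edist_le (p.takeUntil v hv)).trans (by exact_mod_cast hle)

theorem finite_setOf_exists_walk_length_le (hS : S.Finite) (N : ℕ) (g : G) :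
    {h | ∃ p : (SimpleGraph.mulCayley S).Walk g h, p.length ≤ N}.Finite := by
  induction N generalizing g with
  | zero =>
    refine (Set.finite_singleton g).subset fun h ⟨p, hp⟩ => ?_
    exact (SimpleGraph.Walk.eq_of_length_eq_zero (Nat.le_zero.mp hp)).symm
  | succ N ih =>
    refine ((Set.finite_singleton g).union
      ((hS.union hS.inv).biUnion fun s _ => ih (g * s))).subset ?_
    rintro h ⟨_ | ⟨hadj, q⟩, hp⟩
    · exact Or.inl rfl
    · obtain ⟨s, hs, rfl⟩ := exists_eq_mul_of_mulCayley_adj hadj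
      rw [SimpleGraph.Walk.length_cons] at hp
      exact Or.inr (Set.mem_biUnion hs ⟨q, Nat.le_of_succ_le_succ hp⟩)

theorem finite_ball (hS : S.Finite) (R : ℕ) (g : G) : (ball S R g).Finite :=
  (finite_setOf_exists_walk_length_le hS R g).subset fun _ => exists_walk_of_mem_ball

variable {n : ℕ} {H : Fin n → Subgroup G} {X : Fin n → Set G}

theorem finite_separating (hX : ∀ i, IsAlmostInvariant (H i) (X i)) (g h : G) :
    {A ∈ translates X | g ∈ A ∧ h ∉ A}.Finite := by
  refine (Set.finite_iUnion fun i => Set.finite_iUnion fun b => ((hX i).side b).finite_smul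
    (((hX i).side b).isHFinite_mul_notMem (g⁻¹ * h)) g).subset ?_
  rintro A ⟨hA, hg, hh⟩
  obtain ⟨i, b, k, rfl⟩ := mem_translates_iff.mp hA
  rw [Set.mem_smul_set_iff_inv_smul_mem] at hg hh
  exact Set.mem_iUnion₂.mpr ⟨i, b, k, rfl, hg, by simpa [mul_assoc] using hh⟩

theorem mem_nearSets_iff :
    A ∈ nearSets X S R g ↔ A ∈ translates X ∧ ∃ v ∈ ball S R g, v ∈ boundary S A :=
  and_congr_right fun _ => ⟨fun ⟨e, he, v, hv, hve⟩ => ⟨v, hv, e, he, hve⟩,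
    fun ⟨v, hv, e, he, hve⟩ => ⟨e, he, v, hv, hve⟩⟩

theorem finite_nearSets (hX : ∀ i, IsAlmostInvariant (H i) (X i)) (hS : S.Finite) (R : ℕ) (g : G) :
    (nearSets X S R g).Finite := by
  refine ((finite_ball hS R g).biUnion fun v _ => Set.finite_iUnion fun i =>
    Set.finite_iUnion fun b => ((hX i).side b).finite_smul
      (((hX i).side b).isHFinite_boundary hS) v).subset fun A hA => ?_
  obtain ⟨hA, v, hv, hvA⟩ := mem_nearSets_iff.mp hA
  obtain ⟨i, b, k, rfl⟩ := mem_translates_iff.mp hA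
  rw [boundary_smul, Set.mem_smul_set_iff_inv_smul_mem] at hvA
  exact Set.mem_biUnion hv (Set.mem_iUnion₂.mpr ⟨i, b, k, rfl, hvA⟩)

theorem compl_mem_nearSets (hA : A ∈ nearSets X S R g) : Aᶜ ∈ nearSets X S R g := by
  rw [mem_nearSets_iff] at hA ⊢
  rw [boundary_compl]
  exact hA.imp_left compl_mem_translates

theorem ball_subset_of_notMem_nearSets (hA : A ∈ translates X) (hA' : A ∉ nearSets X S R g)
    (hg : g ∈ A) : ball S R g ⊆ A := by
  intro h hh
  obtain ⟨p, hp⟩ := exists_walk_of_mem_ball hh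
  refine (mem_iff_of_forall_support_notMem_boundary p fun v hv hvA => hA' ?_).mp hg
  exact mem_nearSets_iff.mpr ⟨hA, v, mem_ball_of_mem_support hp hv, hvA⟩

end Ball

/-! ### Pairs of sets with an empty corner -/

section EmptyCorner

variable {G : Type*} [Group G] {S : Set G}

theorem mulCayley_preconnected (hS : Subgroup.closure S = ⊤) :
    (SimpleGraph.mulCayley S).Preconnected := by
  have hmul : ∀ t ∈ Subgroup.closure S, ∀ g, (SimpleGraph.mulCayley S).Reachable g (g * t) := by
    intro t ht
    induction ht using Subgroup.closure_induction with
    | mem s hs =>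
      intro g
      by_cases hgs : g = g * s
      · rw [← hgs]
      · exact ((SimpleGraph.mulCayley_adj' S g (g * s)).mpr ⟨hgs, s, hs, Or.inl rfl⟩).reachable
    | one => exact fun g => by rw [mul_one]
    | mul a b _ _ iha ihb => exact fun g => mul_assoc g a b ▸ (iha g).trans (ihb (g * a))
    | inv a _ ih => exact fun g => by simpa using (ih (g * a⁻¹)).symm
  intro g h
  simpa using hmul (g⁻¹ * h) (hS ▸ Subgroup.mem_top _) g

theorem subset_of_boundary_subset (hconn : (SimpleGraph.mulCayley S).Preconnected) {Y Z : Set G}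
    (hY : Y ≠ Set.univ) (hZY : boundary S Z ⊆ Yᶜ) (hYZ : boundary S Y ⊆ Z) : Y ⊆ Z := by
  by_contra hcon
  obtain ⟨y, hy⟩ := Set.not_subset.mp hcon
  obtain ⟨x, hx⟩ := (Set.ne_univ_iff_exists_notMem Y).mp hY
  obtain ⟨p⟩ := hconn y x
  obtain ⟨d, -, ⟨hvY, hvZ⟩, hw⟩ := p.exists_boundary_dart (Y \ Z) hy fun h => hx h.1
  have hsame : ∀ {A : Set G}, d.fst ∉ boundary S A → (d.fst ∈ A ↔ d.snd ∈ A) := fun hA =>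
    not_not.mp fun h => hA (mem_boundary_iff.mpr ⟨d.snd, d.adj, h⟩)
  have hwY : d.snd ∈ Y := (hsame fun h => hvZ (hYZ h)).mp hvY
  have hwZ : d.snd ∉ Z := fun h => hvZ ((hsame fun h' => hZY h' hvY).mpr h)
  exact hw ⟨hwY, hwZ⟩

theorem side_not {G : Type*} {A : Set G} : ∀ b : Bool, side A (!b) = (side A b)ᶜ
  | true => rfl
  | false => (compl_compl A).symm

theorem exists_corner_eq_empty (hconn : (SimpleGraph.mulCayley S).Preconnected) {A B : Set G}
    (hB : ∀ b, side B b ≠ Set.univ) (hAB : ∃ b, boundary S A ⊆ side B b)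
    (hBA : ∃ b, boundary S B ⊆ side A b) : ∃ p, corner A B p = ∅ := by
  obtain ⟨b, hAB⟩ := hAB
  obtain ⟨b', hBA⟩ := hBA
  have hsub : side B (!b) ⊆ side A b' := by
    refine subset_of_boundary_subset hconn (hB _) ?_ ?_
    · rwa [boundary_side, side_not, compl_compl]
    · rwa [boundary_side]
  refine ⟨(!b', !b), ?_⟩
  rw [corner, side_not b']
  exact (Set.disjoint_compl_left_iff_subset.mpr hsub).inter_eq

theorem exists_finite_forall_mem_iff_mul_mem (hconn : (SimpleGraph.mulCayley S).Preconnected)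
    (t : G) : ∃ D : Set G, D.Finite ∧ ∀ (Y : Set G) (g : G),
      (∀ d ∈ D, g * d ∉ boundary S Y) → (g ∈ Y ↔ g * t ∈ Y) := by
  obtain ⟨p⟩ := hconn 1 t
  refine ⟨{d | d ∈ p.support}, p.support.finite_toSet, fun Y g hg => ?_⟩
  have hp := mem_iff_of_forall_support_notMem_boundary (A := g⁻¹ • Y) p fun d hd hdY => ?_
  · simpa [Set.mem_smul_set_iff_inv_smul_mem] using hp
  · rw [boundary_smul, Set.mem_smul_set_iff_inv_smul_mem, inv_inv] at hdY
    exact hg d hd hdY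

theorem exists_finite_forall_one_mem_iff_mem (hconn : (SimpleGraph.mulCayley S).Preconnected)
    {H : Subgroup G} (hH : H.FG) : ∃ D : Set G, D.Finite ∧ ∀ Y : Set G,
      (∀ h ∈ H, ∀ d ∈ D, h * d ∉ boundary S Y) → ∀ h ∈ H, (1 ∈ Y ↔ h ∈ Y) := by
  obtain ⟨T, rfl⟩ := hH
  choose D hD hDY using exists_finite_forall_mem_iff_mul_mem hconn
  refine ⟨⋃ t ∈ T, D t, T.finite_toSet.biUnion fun t _ => hD t, fun Y hY h hh => ?_⟩
  have hgen : ∀ h ∈ Subgroup.closure (T : Set G), ∀ t ∈ T, (h ∈ Y ↔ h * t ∈ Y) :=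
    fun h hh t ht => hDY t Y h fun d hd => hY h hh d (Set.mem_biUnion ht hd)
  induction hh using Subgroup.closure_induction_right with
  | one => rfl
  | mul_right x hx t ht ih => exact ih.trans (hgen x hx t ht)
  | mul_inv_cancel x hx t ht ih =>
    have hmem := mul_mem hx (inv_mem (Subgroup.subset_closure ht))
    exact ih.trans (by simpa using (hgen _ hmem t ht).symm)

theorem exists_finite_subset_side (hconn : (SimpleGraph.mulCayley S).Preconnected)
    {H : Subgroup G} (hH : H.FG) {Z : Set G} (hZ : IsHFinite H Z) :
    ∃ D : Set G, D.Finite ∧ ∀ Y : Set G, (∀ h ∈ H, ∀ d ∈ D, h * d ∉ boundary S Y) →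
      ∃ b, Z ⊆ side Y b := by
  obtain ⟨F, hF, hZF⟩ := hZ
  obtain ⟨D, hD, hDY⟩ := exists_finite_forall_one_mem_iff_mem hconn hH
  choose D' hD' hDY' using exists_finite_forall_mem_iff_mul_mem hconn
  refine ⟨D ∪ ⋃ f ∈ F, D' f, hD.union (hF.biUnion fun f _ => hD' f), fun Y hY => ?_⟩
  have hZY : ∀ z ∈ Z, (1 ∈ Y ↔ z ∈ Y) := by
    intro z hz
    obtain ⟨h, hh, f, hf, rfl⟩ := hZF hz
    exact (hDY Y (fun h hh d hd => hY h hh d (Or.inl hd)) h hh).trans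
      (hDY' f Y h fun d hd => hY h hh d (Or.inr (Set.mem_biUnion hf hd)))
  by_cases h1 : 1 ∈ Y
  · exact ⟨true, fun z hz => (hZY z hz).mp h1⟩
  · exact ⟨false, fun z hz h => h1 ((hZY z hz).mpr h)⟩

/-- If the boundary of `m • Y` comes near `H`, then `m` lies in one of finitely many double
cosets in `H \ G / K`, and a double coset determines the pair `X, m • Y` up to translation. -/
theorem exists_finite_boundary_subset_side_or_smul_mem
    (hconn : (SimpleGraph.mulCayley S).Preconnected) (hS : S.Finite) {H K : Subgroup G}
    (hH : H.FG) {X Y : Set G} (hX : IsAlmostInvariant H X) (hY : IsAlmostInvariant K Y) :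
    ∃ Q : Set (Set G × Set G), Q.Finite ∧ ∀ m : G,
      (∃ b, boundary S X ⊆ side (m • Y) b) ∨ ∃ k : G, (k • X, k • m • Y) ∈ Q := by
  obtain ⟨F, hF, hYF⟩ := hY.isHFinite_boundary hS
  obtain ⟨D, hD, hDY⟩ := exists_finite_subset_side hconn hH (hX.isHFinite_boundary hS)
  refine ⟨Set.image2 (fun f d => ((f * d⁻¹) • X, Y)) F D, hF.image2 _ hD,
    fun m => or_iff_not_imp_left.mpr fun hm => ?_⟩
  obtain ⟨h, hh, d, hd, hmem⟩ : ∃ h ∈ H, ∃ d ∈ D, h * d ∈ boundary S (m • Y) := by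
    by_contra! h
    exact hm (hDY _ h)
  rw [boundary_smul, Set.mem_smul_set_iff_inv_smul_mem] at hmem
  obtain ⟨k, hk, f, hf, hkf⟩ := hYF hmem
  have hfd : f * d⁻¹ = k⁻¹ * m⁻¹ * h := by
    rw [eq_inv_mul_of_mul_eq hkf]
    simp [mul_assoc]
  refine ⟨k⁻¹ * m⁻¹, f, hf, d, hd, Prod.ext ?_ ?_⟩
  · simp only [hfd, mul_smul, hX.smul_eq hh]
  · simp only [mul_smul, inv_smul_smul, hY.smul_eq (inv_mem hk)]

variable {n : ℕ} {H : Fin n → Subgroup G} {X : Fin n → Set G}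

theorem exists_finite_translates_boundary_subset_side_or_smul_mem
    (hconn : (SimpleGraph.mulCayley S).Preconnected) (hS : S.Finite) (hH : ∀ i, (H i).FG)
    (hX : ∀ i, IsAlmostInvariant (H i) (X i)) :
    ∃ Q : Set (Set G × Set G), Q.Finite ∧ ∀ A ∈ translates X, ∀ B ∈ translates X,
      (∃ b, boundary S A ⊆ side B b) ∨ ∃ m : G, (m • A, m • B) ∈ Q := by
  choose Q hQ hQX using fun (i j : Fin n) (b b' : Bool) =>
    exists_finite_boundary_subset_side_or_smul_mem hconn hS (hH i) ((hX i).side b)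
      ((hX j).side b')
  refine ⟨⋃ (i) (j) (b) (b'), Q i j b b', Set.finite_iUnion fun i => Set.finite_iUnion fun j =>
    Set.finite_iUnion fun b => Set.finite_iUnion fun b' => hQ i j b b', fun A hA B hB => ?_⟩
  obtain ⟨i, b, k, rfl⟩ := mem_translates_iff.mp hA
  obtain ⟨j, b', l, rfl⟩ := mem_translates_iff.mp hB
  refine (hQX i j b b' (k⁻¹ * l)).imp (fun ⟨c, hc⟩ => ⟨c, ?_⟩) fun ⟨m, hm⟩ => ⟨m * k⁻¹, ?_⟩
  · rw [mul_smul, side_smul] at hc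
    rwa [boundary_smul, Set.smul_set_subset_iff_subset_inv_smul_set]
  · simp only [Set.mem_iUnion]
    exact ⟨i, j, b, b', by simpa [mul_smul] using hm⟩

theorem exists_finite_corner_eq_empty_or_smul_mem
    (hconn : (SimpleGraph.mulCayley S).Preconnected) (hS : S.Finite) (hH : ∀ i, (H i).FG)
    (hX : ∀ i, IsNontrivialAlmostInvariant (H i) (X i)) :
    ∃ Q : Set (Set G × Set G), Q.Finite ∧ ∀ A ∈ translates X, ∀ B ∈ translates X,
      (∃ p, corner A B p = ∅) ∨ ∃ m : G, (m • A, m • B) ∈ Q := by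
  obtain ⟨Q, hQ, hQE⟩ := exists_finite_translates_boundary_subset_side_or_smul_mem hconn hS hH
    fun i => (hX i).toIsAlmostInvariant
  refine ⟨Q ∪ Prod.swap '' Q, hQ.union (hQ.image _), fun A hA B hB => ?_⟩
  rcases hQE A hA B hB with hAB | ⟨m, hm⟩
  · rcases hQE B hB A hA with hBA | ⟨m, hm⟩
    · have hB' := isNontrivial_of_mem_translates hX hB
      exact Or.inl (exists_corner_eq_empty hconn (fun b => (hB'.side b).ne_univ) hAB hBA)
    · exact Or.inr ⟨m, Or.inr ⟨_, hm, rfl⟩⟩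
  · exact Or.inr ⟨m, Or.inl hm⟩

end EmptyCorner

/-! ### Admissible radii -/

section Radius

open Filter

variable {G : Type*} [Group G] {S : Set G} {R : ℕ} {A B : Set G}

/-- The radius `R` is large enough for the single pair `A`, `B`: a point of `A` whose ball of
radius `R` is contained in `A` lies in `B`. -/
def IsRadiusFor (S : Set G) (R : ℕ) (A B : Set G) : Prop := ∀ g ∈ A, ball S R g ⊆ A → g ∈ B

theorem IsRadiusFor.of_smul {m : G} (h : IsRadiusFor S R (m • A) (m • B)) :
    IsRadiusFor S R A B := by
  intro g hg hball
  have hball' : ball S R (m * g) ⊆ m • A := fun x hx => by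
    rw [Set.mem_smul_set_iff_inv_smul_mem]
    exact hball (by simpa using mem_ball_smul S R m⁻¹ _ _ hx)
  exact Set.smul_mem_smul_set_iff.mp (h (m * g) (Set.smul_mem_smul_set hg) hball')

theorem eventually_mem_ball (hconn : (SimpleGraph.mulCayley S).Preconnected) (g h : G) :
    ∀ᶠ R : ℕ in atTop, h ∈ ball S R g := by
  obtain ⟨p⟩ := hconn g h
  filter_upwards [eventually_ge_atTop p.length] with R hR
  exact mem_ball_of_mem_support hR p.end_mem_support

/-- `A ∩ Bᶜ` is contained in finitely many cosets `H f`. A fixed point outside `A` is at some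
finite distance from `f`, so by `H`-invariance of `A` the complement of `A` is equally close to
every point of `H f`. -/
theorem AlmostLE.eventually_isRadiusFor (hconn : (SimpleGraph.mulCayley S).Preconnected)
    (hA : IsNontrivial A) (hB : IsNontrivial B) (h : AlmostLE A B) :
    ∀ᶠ R : ℕ in atTop, IsRadiusFor S R A B := by
  have hsmall := h.isSmallInter hA
  obtain ⟨a, ha⟩ := (Set.ne_univ_iff_exists_notMem A).mp hA.ne_univ
  obtain ⟨H, hA⟩ := hA
  obtain ⟨F, hF, hABF⟩ := (isSmallInter_iff hA hB.compl).mp hsmall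
  filter_upwards [(eventually_all_finite hF).mpr fun f _ => eventually_mem_ball hconn f a]
    with R hR g hgA hball
  by_contra hgB
  obtain ⟨h, hh, f, hf, rfl⟩ := hABF ⟨hgA, hgB⟩
  have hha : h * a ∈ A := hball (mem_ball_smul S R h f a (hR f hf))
  exact ha ((hA.mul_mem_iff hh).mp hha)

theorem exists_isAdmissibleRadius {n : ℕ} {H : Fin n → Subgroup G} (hH : ∀ i, (H i).FG)
    {X : Fin n → Set G} (hX : ∀ i, IsNontrivialAlmostInvariant (H i) (X i)) (hS : S.Finite)
    (hSG : Subgroup.closure S = ⊤) : ∃ R : ℕ, IsAdmissibleRadius X S R := by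
  have hE : ∀ A ∈ translates X, IsNontrivial A := fun A => isNontrivial_of_mem_translates hX
  have hconn := mulCayley_preconnected hSG
  obtain ⟨Q, hQ, hQE⟩ := exists_finite_corner_eq_empty_or_smul_mem hconn hS hH hX
  have hrad : ∀ᶠ R : ℕ in atTop,
      ∀ p ∈ {p ∈ Q | p.1 ∈ translates X ∧ p.2 ∈ translates X ∧ AlmostLE p.1 p.2},
        IsRadiusFor S R p.1 p.2 :=
    (eventually_all_finite (hQ.subset (Set.sep_subset Q _))).mpr fun p ⟨_, hA, hB, hAB⟩ =>
      hAB.eventually_isRadiusFor hconn (hE _ hA) (hE _ hB)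
  obtain ⟨R, hR, hpos⟩ := (hrad.and (eventually_gt_atTop 0)).exists
  refine ⟨R, hpos, fun A hA B hB hAB => ?_⟩
  rcases hQE A hA B hB with ⟨p, hp⟩ | ⟨m, hm⟩
  · exact fun g hg _ => hAB.subset_of_corner_eq_empty (hE A hA) hp hg
  · exact IsRadiusFor.of_smul (m := m) (hR (m • A, m • B) ⟨hm, smul_mem_translates m hA,
      smul_mem_translates m hB, (almostLE_smul_iff m A B).mpr hAB⟩)

end Radius

/-! ### Basic vertices -/

section BasicVertices

variable {G : Type*} [Group G] {S : Set G} {R n : ℕ} {g : G} {X : Fin n → Set G}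
  {A B : Set G} {U W : Set (Set G)}

theorem isPocset_translates_subset (hE : ∀ A ∈ translates X, IsNontrivial A) :
    IsPocset (translates X) (fun A B => A ⊆ B) where
  compl_mem _ := compl_mem_translates
  refl _ _ := subset_rfl
  antisymm _ _ _ _ := Set.Subset.antisymm
  trans _ _ _ _ _ _ := Set.Subset.trans
  compl _ _ _ _ := Set.compl_subset_compl.mpr
  not_rel_compl A hA h := not_almostLE_compl (hE A hA) (almostLE_of_subset h)

theorem isPocset_translates_almostLE (hE : ∀ A ∈ translates X, IsNontrivial A) :
    IsPocset (translates X) AlmostLE where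
  compl_mem _ := compl_mem_translates
  refl _ _ := almostLE_of_subset subset_rfl
  antisymm A hA B hB := AlmostLE.antisymm (hE A hA) (hE B hB)
  trans A hA B hB D hD := AlmostLE.trans (hE A hA) (hE B hB) (hE D hD)
  compl A hA B hB := AlmostLE.compl (hE A hA) (hE B hB)
  not_rel_compl A hA := not_almostLE_compl (hE A hA)

theorem isUltrafilterOn_basicV (X : Fin n → Set G) (g : G) :
    IsUltrafilterOn (translates X) (fun A B => A ⊆ B) (basicV (translates X) g) where
  subset _ hA := hA.1
  mem_xor A hA := by
    refine ⟨?_, fun h => h.2.2 h.1.2⟩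
    exact (em (g ∈ A)).imp (fun hg => ⟨hA, hg⟩) fun hg => ⟨compl_mem_translates hA, hg⟩
  upward _ hA _ hB hAB := ⟨hB, hAB hA.2⟩

theorem IsUltrafilterOn.of_almostLE {E : Set (Set G)} (h : IsUltrafilterOn E AlmostLE U) :
    IsUltrafilterOn E (fun A B => A ⊆ B) U :=
  ⟨h.subset, h.mem_xor, fun A hA B hB hAB => h.upward A hA B hB (almostLE_of_subset hAB)⟩

theorem mem_of_almostLE_of_mem_initialU (hR : IsAdmissibleRadius X S R)
    (hA : A ∈ initialU X S R g) (hB : B ∈ translates X) (hAB : AlmostLE A B) : g ∈ B :=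
  hR.2 A hA.1.1 B hB hAB g hA.2 (ball_subset_of_notMem_nearSets hA.1.1 hA.1.2 hA.2)

theorem mem_firstU_iff (hR : IsAdmissibleRadius X S R) :
    B ∈ firstU X S R g ↔ B ∈ translates X ∧ ∃ A ∈ initialU X S R g, AlmostLE A B := by
  constructor
  · rintro (hB | ⟨hB, h⟩)
    · exact ⟨hB.1.1, B, hB, almostLE_of_subset subset_rfl⟩
    · exact ⟨hB.1, h⟩
  · rintro ⟨hB, A, hA, hAB⟩
    by_cases hBn : B ∈ nearSets X S R g
    · exact Or.inr ⟨hBn, A, hA, hAB⟩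
    · exact Or.inl ⟨⟨hB, hBn⟩, mem_of_almostLE_of_mem_initialU hR hA hB hAB⟩

theorem isPartialUltrafilterOn_firstU (hE : IsPocset (translates X) AlmostLE)
    (hR : IsAdmissibleRadius X S R) (g : G) :
    IsPartialUltrafilterOn (translates X) AlmostLE (firstU X S R g) where
  subset _ hA := ((mem_firstU_iff hR).mp hA).1
  upward A hA B hB hAB := by
    obtain ⟨hA, A₀, hA₀, hA₀A⟩ := (mem_firstU_iff hR).mp hA
    exact (mem_firstU_iff hR).mpr ⟨hB, A₀, hA₀, hE.trans A₀ hA₀.1.1 A hA B hB hA₀A hAB⟩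
  consistent A hA hAc := by
    obtain ⟨hA, A₀, hA₀, hA₀A⟩ := (mem_firstU_iff hR).mp hA
    obtain ⟨hAc, A₁, hA₁, hA₁A⟩ := (mem_firstU_iff hR).mp hAc
    have hA₁c := hE.compl_mem A₁ hA₁.1.1
    have hAA₁ : AlmostLE A A₁ᶜ := by simpa using hE.compl A₁ hA₁.1.1 Aᶜ hAc hA₁A
    have hg : g ∉ A₁ := mem_of_almostLE_of_mem_initialU hR hA₀ hA₁c
      (hE.trans A₀ hA₀.1.1 A hA A₁ᶜ hA₁c hA₀A hAA₁)
    exact hg hA₁.2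

theorem mem_nearSets_of_initialU_subset (hU : initialU X S R g ⊆ U) (hA : A ∈ translates X)
    (hAU : A ∉ U) (hg : g ∈ A) : A ∈ nearSets X S R g := by
  by_contra hn
  exact hAU (hU ⟨⟨hA, hn⟩, hg⟩)

theorem undecided_subset_nearSets (hU : initialU X S R g ⊆ U) :
    undecided (translates X) U ⊆ nearSets X S R g := by
  rintro A ⟨hA, hAU, hAcU⟩
  by_cases hg : g ∈ A
  · exact mem_nearSets_of_initialU_subset hU hA hAU hg
  · simpa using compl_mem_nearSets
      (mem_nearSets_of_initialU_subset hU (compl_mem_translates hA) hAcU hg)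

theorem symmDiff_basicV_subset_nearSets (hU : initialU X S R g ⊆ U)
    (hU' : IsPartialUltrafilterOn (translates X) AlmostLE U) :
    U ∆ basicV (translates X) g ⊆ nearSets X S R g := by
  rintro A (⟨hAU, hAV⟩ | ⟨hAV, hAU⟩)
  · have hA := hU'.subset hAU
    simpa using compl_mem_nearSets (mem_nearSets_of_initialU_subset hU (compl_mem_translates hA)
      (hU'.consistent A hAU) fun hg => hAV ⟨hA, hg⟩)
  · exact mem_nearSets_of_initialU_subset hU hAV.1 hAU hAV.2

theorem IsBasicW.initialU_subset (hW : IsBasicW X S R g W) : initialU X S R g ⊆ W :=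
  Set.subset_union_left.trans (subset_of_reflTransGen_completionStep hW.1)

theorem IsBasicW.isPartialUltrafilterOn (hW : IsBasicW X S R g W)
    (hE : IsPocset (translates X) AlmostLE) (hR : IsAdmissibleRadius X S R) :
    IsPartialUltrafilterOn (translates X) AlmostLE W :=
  (isPartialUltrafilterOn_firstU hE hR g).of_reflTransGen_completionStep hE hW.1

theorem IsBasicW.isUltrafilterOn (hW : IsBasicW X S R g W)
    (hE : IsPocset (translates X) AlmostLE) (hR : IsAdmissibleRadius X S R) :
    IsUltrafilterOn (translates X) AlmostLE W :=
  (hW.isPartialUltrafilterOn hE hR).isUltrafilterOn hW.2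

end BasicVertices

/-! ### The components `L` and `C` -/

section Components

variable {G : Type*} [Group G] {S : Set G} {R n : ℕ} {g : G} {H : Fin n → Subgroup G}
  {X : Fin n → Set G} {W : Set (Set G)}

theorem exists_isBasicW (hX : ∀ i, IsNontrivialAlmostInvariant (H i) (X i)) (hS : S.Finite)
    (R : ℕ) (g : G) : ∃ W, IsBasicW X S R g W := by
  have hE := isPocset_translates_almostLE fun _ => isNontrivial_of_mem_translates hX
  have hnear := finite_nearSets (fun i => (hX i).toIsAlmostInvariant) hS R g
  exact hE.exists_completion (hnear.subset (undecided_subset_nearSets Set.subset_union_left))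

theorem IsBasicW.finite_symmDiff (hW : IsBasicW X S R g W)
    (hX : ∀ i, IsNontrivialAlmostInvariant (H i) (X i)) (hS : S.Finite)
    (hR : IsAdmissibleRadius X S R) : (W ∆ basicV (translates X) g).Finite := by
  have hE := isPocset_translates_almostLE fun _ => isNontrivial_of_mem_translates hX
  exact (finite_nearSets (fun i => (hX i).toIsAlmostInvariant) hS R g).subset
    (symmDiff_basicV_subset_nearSets hW.initialU_subset (hW.isPartialUltrafilterOn hE hR))

theorem finite_basicV_sdiff (hX : ∀ i, IsAlmostInvariant (H i) (X i)) (g h : G) :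
    (basicV (translates X) g \ basicV (translates X) h).Finite :=
  (finite_separating hX g h).subset fun _ hA => ⟨hA.1.1, hA.1.2, fun h' => hA.2 ⟨hA.1.1, h'⟩⟩

theorem cubingC_connected (hX : ∀ i, IsNontrivialAlmostInvariant (H i) (X i)) :
    (cubingC X).graph.Connected := by
  have hE := isPocset_translates_subset fun _ => isNontrivial_of_mem_translates hX
  refine CubingData.graph_connected hE ⟨⟨_, isUltrafilterOn_basicV X 1⟩, 1, rfl⟩ ?_
  rintro _ ⟨g, rfl⟩ _ ⟨h, rfl⟩
  exact finite_basicV_sdiff (fun i => (hX i).toIsAlmostInvariant) g h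

theorem cubingL_connected (hX : ∀ i, IsNontrivialAlmostInvariant (H i) (X i)) (hS : S.Finite)
    (hR : IsAdmissibleRadius X S R) : (cubingL X S R).graph.Connected := by
  have hE := isPocset_translates_almostLE fun _ => isNontrivial_of_mem_translates hX
  obtain ⟨W₀, hW₀⟩ := exists_isBasicW hX hS R 1
  refine CubingData.graph_connected hE ⟨⟨W₀, hW₀.isUltrafilterOn hE hR⟩, 1, hW₀⟩ ?_
  rintro W ⟨g, hW⟩ W' ⟨h, hW'⟩
  have hV := finite_basicV_sdiff (fun i => (hX i).toIsAlmostInvariant) g h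
  refine ((hW.finite_symmDiff hX hS hR).union
    (hV.union (hW'.finite_symmDiff hX hS hR))).subset fun A ⟨hA, hA'⟩ => ?_
  by_cases hg : A ∈ basicV (translates X) g
  · by_cases hh : A ∈ basicV (translates X) h
    · exact Or.inr (Or.inr (Or.inr ⟨hh, hA'⟩))
    · exact Or.inr (Or.inl ⟨hg, hh⟩)
  · exact Or.inl (Or.inl ⟨hA, hg⟩)

theorem exists_reachable_of_mem_basic (hX : ∀ i, IsNontrivialAlmostInvariant (H i) (X i))
    (hS : S.Finite) (hR : IsAdmissibleRadius X S R) (W : (cubingC X).Ultra)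
    (hW : W.1 ∈ (cubingL X S R).basic) :
    ∃ V : (cubingC X).Ultra, V.1 ∈ (cubingC X).basic ∧ (cubingC X).fullGraph.Reachable V W := by
  obtain ⟨g, hW⟩ := hW
  have hE := isPocset_translates_subset fun _ => isNontrivial_of_mem_translates hX
  refine ⟨⟨_, isUltrafilterOn_basicV X g⟩, ⟨g, rfl⟩, ?_⟩
  exact CubingData.reachable_of_finite_sdiff hE _ _
    ((hW.finite_symmDiff hX hS hR).subset fun _ => Or.inr)

end Components

end MinimalCubing

open MinimalCubing in
theorem mainTheorem1_general {G : Type*} [Group G] {n : ℕ}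
    (H : Fin n → Subgroup G) (hH : ∀ i, (H i).FG)
    (X : Fin n → Set G) (hX : ∀ i, IsNontrivialAlmostInvariant (H i) (X i))
    (S : Set G) (hS : S.Finite) (hSG : Subgroup.closure S = ⊤) :
    ((∀ A ∈ translates X, AlmostLE A A) ∧
      (∀ A ∈ translates X, ∀ B ∈ translates X, AlmostLE A B → AlmostLE B A → A = B) ∧
      (∀ A ∈ translates X, ∀ B ∈ translates X, ∀ D ∈ translates X,
        AlmostLE A B → AlmostLE B D → AlmostLE A D) ∧
      (∀ A ∈ translates X, ∀ B ∈ translates X, AlmostLE A B → AlmostLE Bᶜ Aᶜ)) ∧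
    (∀ V : Set (Set G), IsUltrafilterOn (translates X) AlmostLE V →
      IsUltrafilterOn (translates X) (fun A B => A ⊆ B) V) ∧
    (∀ g : G, IsUltrafilterOn (translates X) (fun A B => A ⊆ B) (basicV (translates X) g)) ∧
    (cubingC X).graph.Connected ∧
    (∃ R : ℕ, IsAdmissibleRadius X S R) ∧
    ∀ R : ℕ, IsAdmissibleRadius X S R →
      (∀ g : G, ∃ W, IsBasicW X S R g W) ∧
      (∀ (g : G) (W : Set (Set G)), IsBasicW X S R g W →
        IsUltrafilterOn (translates X) AlmostLE W ∧
          (symmDiff W (basicV (translates X) g)).Finite) ∧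
      (cubingL X S R).graph.Connected ∧
      ∃ f : (cubingL X S R).graph ↪g (cubingC X).graph,
        (∀ W : (cubingL X S R).Vertex, (f W).1.1 = W.1.1) ∧
        ∃ F : (cubingL X S R).Complex → (cubingC X).Complex,
          F = Realization.map f.toCopy ∧
          Topology.IsEmbedding F ∧
          ∀ (g : G) (x : (cubingL X S R).Complex), F (g • x) = g • F x := by
  have hE := isPocset_translates_almostLE fun _ => isNontrivial_of_mem_translates hX
  refine ⟨⟨hE.refl, hE.antisymm, hE.trans, hE.compl⟩, fun V hV => hV.of_almostLE,
    isUltrafilterOn_basicV X, cubingC_connected hX, exists_isAdmissibleRadius hH hX hS hSG,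
    fun R hR => ⟨exists_isBasicW hX hS R,
      fun g W hW => ⟨hW.isUltrafilterOn hE hR, hW.finite_symmDiff hX hS hR⟩,
      cubingL_connected hX hS hR, ?_⟩⟩
  let f : (cubingL X S R).graph ↪g (cubingC X).graph :=
    CubingData.vertexInclusion (fun V hV => hV.of_almostLE)
      fun W hW => exists_reachable_of_mem_basic hX hS hR _ hW
  exact ⟨f, fun _ => rfl, Realization.map f.toCopy, rfl,
    (isClosedEmbedding_realizationMap f.toCopy).isEmbedding,
    CubingData.realizationMap_smul f.toCopy fun _ _ => rfl⟩

open MinimalCubing in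
theorem mainTheorem1 {G : Type*} [Group G] [Group.FG G] {n : ℕ}
    (H : Fin n → Subgroup G) (hH : ∀ i, (H i).FG)
    (X : Fin n → Set G) (hX : ∀ i, IsNontrivialAlmostInvariant (H i) (X i))
    (hgood : GoodPosition X)
    (S : Set G) (hS : S.Finite) (hSG : Subgroup.closure S = ⊤) :
    -- almost inclusion is a partial order on `E`, reversed by complementation
    ((∀ A ∈ translates X, AlmostLE A A) ∧
      (∀ A ∈ translates X, ∀ B ∈ translates X, AlmostLE A B → AlmostLE B A → A = B) ∧
      (∀ A ∈ translates X, ∀ B ∈ translates X, ∀ D ∈ translates X,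
        AlmostLE A B → AlmostLE B D → AlmostLE A D) ∧
      (∀ A ∈ translates X, ∀ B ∈ translates X, AlmostLE A B → AlmostLE Bᶜ Aᶜ)) ∧
    -- every ultrafilter for almost inclusion is an ultrafilter for inclusion
    (∀ V : Set (Set G), IsUltrafilterOn (translates X) AlmostLE V →
      IsUltrafilterOn (translates X) (fun A B => A ⊆ B) V) ∧
    -- `C` is a single component containing all `V_g`
    (∀ g : G, IsUltrafilterOn (translates X) (fun A B => A ⊆ B) (basicV (translates X) g)) ∧
    (cubingC X).graph.Connected ∧
    -- the construction of `L` can be carried out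
    (∃ R : ℕ, IsAdmissibleRadius X S R) ∧
    ∀ R : ℕ, IsAdmissibleRadius X S R →
      -- basic vertices `W_g` exist, and differ from `V_g` in finitely many places
      (∀ g : G, ∃ W, IsBasicW X S R g W) ∧
      (∀ (g : G) (W : Set (Set G)), IsBasicW X S R g W →
        IsUltrafilterOn (translates X) AlmostLE W ∧
          (symmDiff W (basicV (translates X) g)).Finite) ∧
      -- `L` is a single component containing all `W_g`
      (cubingL X S R).graph.Connected ∧
      -- the inclusion of the vertices induces a `G`-equivariant embedding of `L` in `C`
      ∃ f : (cubingL X S R).graph ↪g (cubingC X).graph,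
        (∀ W : (cubingL X S R).Vertex, (f W).1.1 = W.1.1) ∧
        ∃ F : (cubingL X S R).Complex → (cubingC X).Complex,
          F = Realization.map f.toCopy ∧
          Topology.IsEmbedding F ∧
          ∀ (g : G) (x : (cubingL X S R).Complex), F (g • x) = g • F x :=
  mainTheorem1_general H hH X hX S hS hSG
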